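/- Let $q\in\mathbb{C}\setminus\{0,1\}$ and let $\Theta_0,\Theta_1,\Theta_t,\Theta_\infty\in\mathbb{C}^*$ be such that $$\Theta_0^2\neq 1,\qquad \Theta_1^2\neq 1,\qquad \Theta_t^2\neq 1,\qquad \Theta_\infty^2\neq q .$$ Put $$S_q:=\{\Theta_1^{\varepsilon_1}\Theta_t^{\varepsilon_t}q^n,\ \Theta_0^{\varepsilon_0}\Theta_\infty^{\varepsilon_\infty}q^n \mid \varepsilon_0,\varepsilon_1,\varepsilon_t,\varepsilon_\infty\in\{1,-1\},\ n\in\mathbb{Z}\}.$$ Consider the rational functions $$g(y,z,t)=\frac{(y-t\Theta_t)(y-t/\Theta_t)}{q\,z\,(y-\Theta_1)(y-1/\Theta_1)},\qquad f(y,z,t)=\frac{(g-t\Theta_0)(g-t/\Theta_0)}{y\,(g-\Theta_\infty/q)(g-1/\Theta_\infty)},\quad g=g(y,z,t),$$ and, for $t\in\mathbb{C}^*\setminus S_q$, the rational map $\mathfrak{S}_t:\mathbb{P}^1\times\mathbb{P}^1\dashrightarrow\mathbb{P}^1\times\mathbb{P}^1$, $(y,z)\mapsto(f(y,z,t),g(y,z,t))$.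 Let $\mathfrak{P}_t$ be the blow-up of $\mathbb{P}^1\times\mathbb{P}^1$ at its eight critical points, namely $$\Big(0,\tfrac{t\Theta_0}{q}\Big),\ \Big(0,\tfrac{t}{q\Theta_0}\Big),\ \Big(\tfrac1{\Theta_1},\infty\Big),\ (\Theta_1,\infty),\ (t\Theta_t,0),\ \Big(\tfrac{t}{\Theta_t},0\Big),\ \Big(\infty,\tfrac1{\Theta_\infty}\Big),\ \Big(\infty,\tfrac{\Theta_\infty}{q}\Big).$$ (1) For every $t\in\mathbb{C}^*\setminus S_q$, the rational map $\mathfrak{P}_t\dashrightarrow\mathfrak{P}_{qt}$ induced by $\mathfrak{S}_t$ via the blow-down maps is biregular: there is a bijection $F:\mathfrak{P}_t\to\mathfrak{P}_{qt}$ such that $F$ and $F^{-1}$ are regular and such that, for every point of $\mathfrak{P}_t$ lying over a non-critical point $p$, its image under $F$ lies over $\mathfrak{S}_t(p)$. In particular, $F$ is biholomorphic. (2) For all $y_0,z_0\in\mathbb{C}^*$ and $t_0\in\mathbb{C}^*\setminus S_q$ there is exactly one discrete solution with initial value $(y_0,z_0,t_0)$. Here such a discrete solution is a sequence $(y_\ell,z_\ell,t_\ell)_{\ell\in\mathbb{Z}}$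 of points of $\mathbb{P}^1\times\mathbb{P}^1\times\mathbb{C}^*$ with the given value at $\ell=0$ and $t_\ell=q^\ell t_0$ for all $\ell$, such that for all $\ell\in\mathbb{Z}$ $$y_\ell\, y_{\ell+1}=\frac{(z_{\ell+1}-t_\ell\Theta_0)(z_{\ell+1}-t_\ell/\Theta_0)}{(z_{\ell+1}-1/\Theta_\infty)(z_{\ell+1}-\Theta_\infty/q)},\qquad z_\ell\, z_{\ell+1}=\frac1q\,\frac{(y_\ell-t_\ell\Theta_t)(y_\ell-t_\ell/\Theta_t)}{(y_\ell-\Theta_1)(y_\ell-1/\Theta_1)}$$ (read in homogeneous coordinates, cleared of denominators), and such that moreover, for every $\ell\in\mathbb{Z}$, the relations $y_\ell=f_\ell(y_0,z_0,t_0)$ and $z_\ell=g_\ell(y_0,z_0,t_0)$ hold after rational simplification, where $f_\ell,g_\ell\in\mathbb{C}(y,z,t)$ are the rational functions obtained by iterating the recurrence formally $\ell$ times (backwards if $\ell<0$) from $(y,z)$ at time $t$: for $f_\ell=P/Q$ with coprime polynomials $P,Q$, the relation is $y_\ell\,Q(y_0,z_0,t_0)=P(y_0,z_0,t_0)$, again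 in homogeneous coordinates of $y_\ell\in\mathbb{P}^1$, and likewise for $g_\ell$. -/

import Mathlib

noncomputable section

namespace QPVI

/-! ### The complex projective line -/

/-- The complex projective line, as `ℂ ∪ {∞}`. -/
abbrev P1 : Type := OnePoint ℂ

/-- The point `∞` of the projective line. -/
def infPt : P1 := OnePoint.infty

/-- The point `[a : b]` of the projective line (meaningful if `a` and `b` do not both vanish). -/
def ratio (a b : ℂ) : P1 := if b = 0 then infPt else ((a / b : ℂ) : P1)

/-- First homogeneous coordinate: `p = [num p : den p]`. -/
def num (p : P1) : ℂ := p.elim 1 (fun c => c)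

/-- Second homogeneous coordinate: `p = [num p : den p]`. -/
def den (p : P1) : ℂ := p.elim 0 (fun _ => 1)

/-- The affine parametrization of a neighbourhood of `p` that sends `0` to `p`:
`s ↦ c + s` around a finite point `c`, and `s ↦ 1 / s` around `∞`. -/
def coordAt (p : P1) (s : ℂ) : P1 := p.elim (ratio 1 s) (fun c => ((c + s : ℂ) : P1))

/-! ### Blowing up points of `ℙ¹ × ℙ¹` -/

/-- The points of the blow-up of `ℙ¹ × ℙ¹` at the points of `Γ`: a point outside `Γ`, or a point of
`Γ` together with a tangent direction there. The direction is given by its slope, with respect to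
the local coordinates `(coordAt γ.1, coordAt γ.2)` centred at `γ`. -/
inductive BlowUp (Γ : Set (P1 × P1)) : Type
  | base (p : P1 × P1) (h : p ∉ Γ) : BlowUp Γ
  | exc (γ : P1 × P1) (h : γ ∈ Γ) (slope : P1) : BlowUp Γ

/-- The blow-down map to `ℙ¹ × ℙ¹`. -/
def BlowUp.down {Γ : Set (P1 × P1)} : BlowUp Γ → P1 × P1
  | .base p _ => p
  | .exc γ _ _ => γ

/-- Labels of the affine charts of the blow-up: a chart around each point that is not blown up, and
the two usual charts over a neighbourhood of each point that is blown up. -/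
inductive Chart (Γ : Set (P1 × P1)) : Type
  | plain (p : P1 × P1) (h : p ∉ Γ) : Chart Γ
  | first (γ : P1 × P1) (h : γ ∈ Γ) : Chart Γ
  | second (γ : P1 × P1) (h : γ ∈ Γ) : Chart Γ

/-- The chart, followed by the blow-down map. In the local coordinates of `ℙ¹ × ℙ¹` it is
`(u, v) ↦ (u, v)`, `(u, v) ↦ (u, u v)` and `(u, v) ↦ (u v, v)` respectively. -/
def Chart.down {Γ : Set (P1 × P1)} : Chart Γ → (Fin 2 → ℂ) → P1 × P1
  | .plain p _, a => (coordAt p.1 (a 0), coordAt p.2 (a 1))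
  | .first γ _, a => (coordAt γ.1 (a 0), coordAt γ.2 (a 0 * a 1))
  | .second γ _, a => (coordAt γ.1 (a 0 * a 1), coordAt γ.2 (a 1))

/-- `k.Rep a x`: the point with coordinates `a` in the chart `k` is `x`. The domain of the chart
`k` is the Zariski-open set of all `a` for which there is such an `x`. -/
def Chart.Rep {Γ : Set (P1 × P1)} (k : Chart Γ) (a : Fin 2 → ℂ) : BlowUp Γ → Prop
  | .base p _ => k.down a = p
  | .exc γ _ m =>
    match k with
    | .plain _ _ => False
    | .first γ' _ => γ' = γ ∧ a 0 = 0 ∧ m = ((a 1 : ℂ) : P1)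
    | .second γ' _ => γ' = γ ∧ a 1 = 0 ∧ m = ratio 1 (a 0)

/-- A map between blow-ups is regular (a morphism of algebraic varieties) if around every point it
is given, in suitable charts, by rational functions whose denominators do not vanish there. -/
def IsRegular {Γ Γ' : Set (P1 × P1)} (F : BlowUp Γ → BlowUp Γ') : Prop :=
  ∀ x : BlowUp Γ, ∃ (k : Chart Γ) (k' : Chart Γ') (a : Fin 2 → ℂ)
    (A B C D : MvPolynomial (Fin 2) ℂ),
    k.Rep a x ∧ MvPolynomial.eval a B ≠ 0 ∧ MvPolynomial.eval a D ≠ 0 ∧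
    ∀ (b : Fin 2 → ℂ) (x' : BlowUp Γ), k.Rep b x' →
      MvPolynomial.eval b B ≠ 0 → MvPolynomial.eval b D ≠ 0 →
      k'.Rep ![MvPolynomial.eval b A / MvPolynomial.eval b B,
        MvPolynomial.eval b C / MvPolynomial.eval b D] (F x')

/-- A map between blow-ups is holomorphic if around every point it is given, in suitable charts,
by holomorphic functions. -/
def IsHolomorphic {Γ Γ' : Set (P1 × P1)} (F : BlowUp Γ → BlowUp Γ') : Prop :=
  ∀ x : BlowUp Γ, ∃ (k : Chart Γ) (k' : Chart Γ') (a : Fin 2 → ℂ) (U : Set (Fin 2 → ℂ))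
    (φ : (Fin 2 → ℂ) → (Fin 2 → ℂ)),
    k.Rep a x ∧ IsOpen U ∧ a ∈ U ∧ DifferentiableOn ℂ φ U ∧
    ∀ (b : Fin 2 → ℂ) (x' : BlowUp Γ), k.Rep b x' → b ∈ U → k'.Rep (φ b) (F x')

/-! ### The `q`-Painlevé VI map -/

/-- Spectral data `(Θ₀, Θ₁, Θ_t, Θ_∞)`. -/
structure Spectral where
  Θ0 : ℂ
  Θ1 : ℂ
  Θt : ℂ
  Θinf : ℂ

/-- The excluded times
`S_q = {Θ₁^{±1} Θ_t^{±1}, Θ₀^{±1} Θ_∞^{±1}} · q^ℤ` (all signs independent). -/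
def excludedTimes (q : ℂ) (S : Spectral) : Set ℂ :=
  {s | ∃ ε ∈ ({1, -1} : Set ℤ), ∃ δ ∈ ({1, -1} : Set ℤ), ∃ n : ℤ,
    s = S.Θ1 ^ ε * S.Θt ^ δ * q ^ n ∨ s = S.Θ0 ^ ε * S.Θinf ^ δ * q ^ n}

/-- The eight critical points of the `q`-Painlevé VI map at time `t`. -/
def centers (q : ℂ) (S : Spectral) (t : ℂ) : Set (P1 × P1) :=
  {(((0 : ℂ) : P1), ((t * S.Θ0 / q : ℂ) : P1)), (((0 : ℂ) : P1), ((t * S.Θ0⁻¹ / q : ℂ) : P1)),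
   (((S.Θ1⁻¹ : ℂ) : P1), infPt), (((S.Θ1 : ℂ) : P1), infPt),
   (((t * S.Θt : ℂ) : P1), ((0 : ℂ) : P1)), (((t * S.Θt⁻¹ : ℂ) : P1), ((0 : ℂ) : P1)),
   (infPt, ((S.Θinf⁻¹ : ℂ) : P1)), (infPt, ((S.Θinf / q : ℂ) : P1))}

/-- The surface `𝔓_t`. -/
abbrev Surface (q : ℂ) (S : Spectral) (t : ℂ) : Type := BlowUp (centers q S t)

section Homogeneous

variable (q : ℂ) (S : Spectral) (t : ℂ)

/-- Numerator of `g = (y - tΘ_t)(y - t/Θ_t) / (q z (y - Θ₁)(y - 1/Θ₁))` in homogeneous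
coordinates of `y` and `z`. -/
def gNum (p : P1 × P1) : ℂ :=
  (num p.1 - t * S.Θt * den p.1) * (num p.1 - t * S.Θt⁻¹ * den p.1) * den p.2

/-- Denominator of `g` in homogeneous coordinates. -/
def gDen (p : P1 × P1) : ℂ :=
  q * num p.2 * (num p.1 - S.Θ1 * den p.1) * (num p.1 - S.Θ1⁻¹ * den p.1)

/-- Numerator of `f = (g - tΘ₀)(g - t/Θ₀) / (y (g - Θ_∞/q)(g - 1/Θ_∞))` in homogeneous
coordinates. -/
def fNum (p : P1 × P1) : ℂ :=
  den p.1 * (gNum S t p - t * S.Θ0 * gDen q S p) * (gNum S t p - t * S.Θ0⁻¹ * gDen q S p)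

/-- Denominator of `f` in homogeneous coordinates. -/
def fDen (p : P1 × P1) : ℂ :=
  num p.1 * (gNum S t p - S.Θinf / q * gDen q S p) * (gNum S t p - S.Θinf⁻¹ * gDen q S p)

/-- The `q`-Painlevé VI map `𝔖_t : (y, z) ↦ (f(y, z, t), g(y, z, t))` of `ℙ¹ × ℙ¹`; its values are
meaningful outside the critical points. -/
def painleveMap (p : P1 × P1) : P1 × P1 :=
  (ratio (fNum q S t p) (fDen q S t p), ratio (gNum S t p) (gDen q S p))

end Homogeneous

/-! ### Discrete solutions -/

/-- The field `ℂ(y, z, t)` of rational functions in three variables. -/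
abbrev RatField : Type := FractionRing (MvPolynomial (Fin 3) ℂ)

/-- A complex number as a constant rational function. -/
def cst (c : ℂ) : RatField := algebraMap ℂ RatField c

/-- The variables `y`, `z`, `t` of `ℂ(y, z, t)`, for `i = 0, 1, 2`. -/
def var (i : Fin 3) : RatField := algebraMap (MvPolynomial (Fin 3) ℂ) RatField (MvPolynomial.X i)

/-- The right-hand side of `z · σz = (y - tΘ_t)(y - t/Θ_t) / (q (y - Θ₁)(y - 1/Θ₁))`. -/
def zRhs (q : ℂ) (S : Spectral) (t y : RatField) : RatField :=
  (y - t * cst S.Θt) * (y - t * cst S.Θt⁻¹) / (cst q * (y - cst S.Θ1) * (y - cst S.Θ1⁻¹))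

/-- The right-hand side of `y · σy = (σz - tΘ₀)(σz - t/Θ₀) / ((σz - 1/Θ_∞)(σz - Θ_∞/q))`. -/
def yRhs (q : ℂ) (S : Spectral) (t z' : RatField) : RatField :=
  (z' - t * cst S.Θ0) * (z' - t * cst S.Θ0⁻¹) / ((z' - cst S.Θinf⁻¹) * (z' - cst (S.Θinf / q)))

/-- The recurrence at time `t`, solved for the next pair. -/
def stepForward (q : ℂ) (S : Spectral) (t : RatField) (w : RatField × RatField) :
    RatField × RatField :=
  (yRhs q S t (zRhs q S t w.1 / w.2) / w.1, zRhs q S t w.1 / w.2)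

/-- The recurrence at time `t`, solved for the previous pair. -/
def stepBackward (q : ℂ) (S : Spectral) (t : RatField) (w : RatField × RatField) :
    RatField × RatField :=
  (yRhs q S t w.2 / w.1, zRhs q S t (yRhs q S t w.2 / w.1) / w.2)

/-- The `n`-th forward iterate, starting at time `t` from `(y, z)`. -/
def iterForward (q : ℂ) (S : Spectral) : ℕ → RatField × RatField
  | 0 => (var 0, var 1)
  | n + 1 => stepForward q S (cst (q ^ n) * var 2) (iterForward q S n)

/-- The `n`-th backward iterate, starting at time `t` from `(y, z)`. -/
def iterBackward (q : ℂ) (S : Spectral) : ℕ → RatField × RatField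
  | 0 => (var 0, var 1)
  | n + 1 => stepBackward q S (cst (q ^ (-(n + 1 : ℤ))) * var 2) (iterBackward q S n)

/-- The pair of rational functions of `(y, z, t)` that expresses, by the recurrence, the `ℓ`-th
pair in terms of the pair `(y, z)` at `ℓ = 0` and the time `t` at `ℓ = 0`. -/
def iterate (q : ℂ) (S : Spectral) : ℤ → RatField × RatField
  | .ofNat n => iterForward q S n
  | .negSucc n => iterBackward q S (n + 1)

/-- The relation `v = φ(y, z, t)` at the point `a` of `ℂ³`, after all cancellations: all relations
`v · Q(a) = P(a)` with `φ = P / Q` hold, equivalently the one where `P / Q` is in lowest terms.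
(The value `v = ∞` is allowed; the relations are written in homogeneous coordinates of `v`.) -/
def SatisfiesSimplified (φ : RatField) (a : Fin 3 → ℂ) (v : P1) : Prop :=
  ∀ P Q : MvPolynomial (Fin 3) ℂ, Q ≠ 0 →
    φ = algebraMap (MvPolynomial (Fin 3) ℂ) RatField P /
      algebraMap (MvPolynomial (Fin 3) ℂ) RatField Q →
    num v * MvPolynomial.eval a Q = den v * MvPolynomial.eval a P

/-- The recurrence relations
`y y' = (z' - tΘ₀)(z' - t/Θ₀) / ((z' - 1/Θ_∞)(z' - Θ_∞/q))`,
`z z' = (y - tΘ_t)(y - t/Θ_t) / (q (y - Θ₁)(y - 1/Θ₁))`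
between points of `ℙ¹ × ℙ¹`, cleared of denominators in homogeneous coordinates. -/
def Recurrence (q : ℂ) (S : Spectral) (t : ℂ) (y z y' z' : P1) : Prop :=
  num y * num y' * ((num z' - S.Θinf⁻¹ * den z') * (num z' - S.Θinf / q * den z')) =
      den y * den y' * ((num z' - t * S.Θ0 * den z') * (num z' - t * S.Θ0⁻¹ * den z')) ∧
  num z * num z' * (q * (num y - S.Θ1 * den y) * (num y - S.Θ1⁻¹ * den y)) =
      den z * den z' * ((num y - t * S.Θt * den y) * (num y - t * S.Θt⁻¹ * den y))

/-- Discrete solutions `(y_ℓ, z_ℓ, t_ℓ)`, `ℓ ∈ ℤ`, of the `q`-Painlevé VI equation with finite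
initial value `(y₀, z₀, t₀)` at `ℓ = 0`. -/
structure IsDiscreteSolution (q : ℂ) (S : Spectral) (y₀ z₀ t₀ : ℂ) (s : ℤ → P1 × P1 × ℂ) :
    Prop where
  init : s 0 = ((y₀ : P1), (z₀ : P1), t₀)
  time : ∀ l : ℤ, (s l).2.2 = q ^ l * t₀
  recurrence : ∀ l : ℤ, Recurrence q S (s l).2.2 (s l).1 (s l).2.1 (s (l + 1)).1 (s (l + 1)).2.1
  simplified : ∀ l : ℤ, SatisfiesSimplified (iterate q S l).1 ![y₀, z₀, t₀] (s l).1 ∧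
    SatisfiesSimplified (iterate q S l).2 ![y₀, z₀, t₀] (s l).2.1

end QPVI

end

noncomputable section

namespace QPVI

/-! ### Values of rational functions at points of affine space -/

/-- The field of rational functions in the variables `σ`. -/
abbrev RatFun (σ : Type) : Type := FractionRing (MvPolynomial σ ℂ)

/-- A polynomial as a rational function. -/
abbrev ofPoly {σ : Type} (P : MvPolynomial σ ℂ) : RatFun σ := algebraMap _ _ P

section Values

variable {σ : Type} {a : σ → ℂ}

/-- The rational function `x` is regular at `a`, with value `c`. -/
def Val (a : σ → ℂ) (x : RatFun σ) (c : ℂ) : Prop :=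
  ∃ P Q : MvPolynomial σ ℂ, MvPolynomial.eval a Q ≠ 0 ∧ x = ofPoly P / ofPoly Q ∧
    c = MvPolynomial.eval a P / MvPolynomial.eval a Q

/-- The rational function `x`, viewed as a map to the projective line, is regular at `a` with
value `p`. -/
def PVal (a : σ → ℂ) (x : RatFun σ) (p : P1) : Prop :=
  p.elim (x ≠ 0 ∧ Val a x⁻¹ 0) (fun c => Val a x c)

theorem ofPoly_injective : Function.Injective (ofPoly : MvPolynomial σ ℂ → RatFun σ) :=
  IsFractionRing.injective _ _

theorem ofPoly_ne_zero {P : MvPolynomial σ ℂ} : ofPoly P ≠ 0 ↔ P ≠ 0 := by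
  rw [Ne, Ne, ← map_zero (algebraMap (MvPolynomial σ ℂ) (RatFun σ))]
  exact not_congr ofPoly_injective.eq_iff

theorem ofPoly_ne_zero_of_eval {Q : MvPolynomial σ ℂ} (h : MvPolynomial.eval a Q ≠ 0) :
    ofPoly Q ≠ 0 :=
  ofPoly_ne_zero.2 fun h' => h (by simp [h'])

theorem ofPoly_div_eq_iff {P Q P' Q' : MvPolynomial σ ℂ} (hQ : Q ≠ 0) (hQ' : Q' ≠ 0) :
    ofPoly P / ofPoly Q = ofPoly P' / ofPoly Q' ↔ P * Q' = P' * Q := by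
  rw [div_eq_div_iff (ofPoly_ne_zero.2 hQ) (ofPoly_ne_zero.2 hQ'), ← map_mul, ← map_mul]
  exact ofPoly_injective.eq_iff

theorem ne_zero_of_eval {Q : MvPolynomial σ ℂ} (h : MvPolynomial.eval a Q ≠ 0) : Q ≠ 0 :=
  fun h' => h (by simp [h'])

theorem Val.unique {x : RatFun σ} {c d : ℂ} (h : Val a x c) (h' : Val a x d) : c = d := by
  obtain ⟨P, Q, hQ, hx, rfl⟩ := h
  obtain ⟨P', Q', hQ', hx', rfl⟩ := h'
  have := (ofPoly_div_eq_iff (ne_zero_of_eval hQ) (ne_zero_of_eval hQ')).1 (hx.symm.trans hx')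
  rw [div_eq_div_iff hQ hQ', ← map_mul, this, map_mul]

theorem Val.ofPoly (P : MvPolynomial σ ℂ) : Val a (ofPoly P) (MvPolynomial.eval a P) :=
  ⟨P, 1, by simp, by simp, by simp⟩

theorem Val.const (c : ℂ) : Val a (algebraMap ℂ (RatFun σ) c) c := by
  have := Val.ofPoly (a := a) (MvPolynomial.C c)
  rwa [MvPolynomial.eval_C, QPVI.ofPoly, ← MvPolynomial.algebraMap_eq,
    ← IsScalarTower.algebraMap_apply] at this

theorem Val.zero : Val a (0 : RatFun σ) 0 := by simpa using Val.const (a := a) 0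

theorem Val.one : Val a (1 : RatFun σ) 1 := by simpa using Val.const (a := a) 1

theorem Val.add {x y : RatFun σ} {c d : ℂ} (h : Val a x c) (h' : Val a y d) :
    Val a (x + y) (c + d) := by
  obtain ⟨P, Q, hQ, rfl, rfl⟩ := h
  obtain ⟨P', Q', hQ', rfl, rfl⟩ := h'
  refine ⟨P * Q' + Q * P', Q * Q', by simp [hQ, hQ'], ?_, ?_⟩
  · rw [div_add_div _ _ (ofPoly_ne_zero_of_eval hQ) (ofPoly_ne_zero_of_eval hQ')]
    simp
  · rw [div_add_div _ _ hQ hQ']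
    simp

theorem Val.mul {x y : RatFun σ} {c d : ℂ} (h : Val a x c) (h' : Val a y d) :
    Val a (x * y) (c * d) := by
  obtain ⟨P, Q, hQ, rfl, rfl⟩ := h
  obtain ⟨P', Q', hQ', rfl, rfl⟩ := h'
  exact ⟨P * P', Q * Q', by simp [hQ, hQ'], by simp [div_mul_div_comm], by
    simp [div_mul_div_comm]⟩

theorem Val.neg {x : RatFun σ} {c : ℂ} (h : Val a x c) : Val a (-x) (-c) := by
  simpa using (Val.const (a := a) (-1)).mul h

theorem Val.sub {x y : RatFun σ} {c d : ℂ} (h : Val a x c) (h' : Val a y d) :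
    Val a (x - y) (c - d) := by
  simpa [sub_eq_add_neg] using h.add h'.neg

theorem Val.inv {x : RatFun σ} {c : ℂ} (h : Val a x c) (hc : c ≠ 0) : Val a x⁻¹ c⁻¹ := by
  obtain ⟨P, Q, hQ, rfl, rfl⟩ := h
  exact ⟨Q, P, fun h => hc (by simp [h]), by simp, by simp⟩

theorem Val.div {x y : RatFun σ} {c d : ℂ} (h : Val a x c) (h' : Val a y d) (hd : d ≠ 0) :
    Val a (x / y) (c / d) := by
  simpa [div_eq_mul_inv] using h.mul (h'.inv hd)

theorem Val.ne_zero {x : RatFun σ} {c : ℂ} (h : Val a x c) (hc : c ≠ 0) : x ≠ 0 := by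
  rintro rfl
  exact hc (h.unique Val.zero)

@[simp]
theorem pval_coe {x : RatFun σ} {c : ℂ} : PVal a x (c : P1) ↔ Val a x c := Iff.rfl

theorem pval_infPt {x : RatFun σ} : PVal a x infPt ↔ x ≠ 0 ∧ Val a x⁻¹ 0 := Iff.rfl

/-! ### Homogeneous coordinates on the projective line. -/

@[simp] theorem num_coe (c : ℂ) : num (c : P1) = c := rfl

@[simp] theorem den_coe (c : ℂ) : den (c : P1) = 1 := rfl

@[simp] theorem num_infPt : num infPt = 1 := rfl

@[simp] theorem den_infPt : den infPt = 0 := rfl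

theorem coe_ne_infPt (c : ℂ) : (c : P1) ≠ infPt := OnePoint.coe_ne_infty c

theorem infPt_ne_coe (c : ℂ) : infPt ≠ (c : P1) := OnePoint.infty_ne_coe c

theorem P1.cases (p : P1) : p = infPt ∨ ∃ c : ℂ, p = c := by
  induction p using OnePoint.rec with
  | infty => exact Or.inl rfl
  | coe c => exact Or.inr ⟨c, rfl⟩

theorem den_eq_zero_iff {p : P1} : den p = 0 ↔ p = infPt := by
  rcases P1.cases p with rfl | ⟨c, rfl⟩ <;> simp [coe_ne_infPt]

theorem num_eq_zero_iff {p : P1} : num p = 0 ↔ p = ((0 : ℂ) : P1) := by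
  rcases P1.cases p with rfl | ⟨c, rfl⟩
  · simp [infPt_ne_coe]
  · simp

theorem num_sub_mul_den_eq_zero_iff {p : P1} {c : ℂ} : num p - c * den p = 0 ↔ p = (c : P1) := by
  rcases P1.cases p with rfl | ⟨d, rfl⟩
  · simp [infPt_ne_coe]
  · simp [sub_eq_zero]

theorem num_mul_den_inj {p p' : P1} (h : num p * den p' = den p * num p') : p = p' := by
  rcases P1.cases p with rfl | ⟨c, rfl⟩ <;> rcases P1.cases p' with rfl | ⟨c', rfl⟩ <;>
    simp_all

/-- Cross-multiplying with the representation that is regular at `a` gives a polynomial identity,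
which can be evaluated even where `P` and `Q` both vanish. This is how a value comes to satisfy
`SatisfiesSimplified`. -/
theorem PVal.num_mul_eval {x : RatFun σ} {p : P1} (h : PVal a x p) {P Q : MvPolynomial σ ℂ}
    (hQ : Q ≠ 0) (hx : x = ofPoly P / ofPoly Q) :
    num p * MvPolynomial.eval a Q = den p * MvPolynomial.eval a P := by
  rcases P1.cases p with rfl | ⟨c, rfl⟩
  · obtain ⟨h0, P', Q', hQ', hx', hc⟩ := h
    have hP : P ≠ 0 := fun h => h0 (by simp [hx, h])
    rw [hx, inv_div, ofPoly_div_eq_iff hP (ne_zero_of_eval hQ')] at hx'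
    have h2 := congrArg (MvPolynomial.eval a) hx'
    rw [eq_comm, div_eq_zero_iff, or_iff_left hQ'] at hc
    simp only [map_mul, hc, zero_mul, mul_eq_zero, or_iff_left hQ'] at h2
    simp [h2]
  · obtain ⟨P', Q', hQ', hx', rfl⟩ := h
    rw [hx, ofPoly_div_eq_iff hQ (ne_zero_of_eval hQ')] at hx'
    have h2 := congrArg (MvPolynomial.eval a) hx'
    simp only [map_mul] at h2
    simp only [num_coe, den_coe, one_mul]
    rw [div_mul_eq_mul_div, div_eq_iff hQ', h2]

/-- The representation witnessing regularity has numerator and denominator not both zero at `a`, so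
its homogeneous relation has a single solution. Uniqueness of values and of discrete solutions both
rest on this. -/
theorem PVal.exists_poly {x : RatFun σ} {p : P1} (h : PVal a x p) :
    ∃ P Q : MvPolynomial σ ℂ, Q ≠ 0 ∧ x = QPVI.ofPoly P / QPVI.ofPoly Q ∧
      ∀ p', num p' * MvPolynomial.eval a Q = den p' * MvPolynomial.eval a P → p' = p := by
  rcases P1.cases p with rfl | ⟨c, rfl⟩
  · obtain ⟨h0, P, Q, hQ, hx, hc⟩ := h
    rw [eq_comm, div_eq_zero_iff, or_iff_left hQ] at hc
    refine ⟨Q, P, ?_, by rw [← inv_div, ← hx, inv_inv], fun p' hp' => ?_⟩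
    · rintro rfl
      simp [h0] at hx
    · rw [hc, mul_zero, eq_comm, mul_eq_zero, or_iff_left hQ] at hp'
      exact den_eq_zero_iff.1 hp'
  · obtain ⟨P, Q, hQ, hx, rfl⟩ := h
    refine ⟨P, Q, ne_zero_of_eval hQ, hx, fun p' hp' => num_mul_den_inj ?_⟩
    simp only [num_coe, den_coe, mul_one]
    rw [mul_div_assoc', eq_div_iff hQ, hp']

theorem PVal.unique {x : RatFun σ} {p p' : P1} (h : PVal a x p) (h' : PVal a x p') : p = p' := by
  obtain ⟨P, Q, hQ, hx, hu⟩ := h'.exists_poly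
  exact hu _ (h.num_mul_eval hQ hx)

/-- A value of a rational function differs from a given one on a Zariski-open set. -/
theorem PVal.exists_open_ne {x : RatFun σ} {p p' : P1} (h : PVal a x p) (hne : p' ≠ p) :
    ∃ H : MvPolynomial σ ℂ, MvPolynomial.eval a H ≠ 0 ∧
      ∀ b, MvPolynomial.eval b H ≠ 0 → ¬ PVal b x p' := by
  obtain ⟨P, Q, hQ, hx, hu⟩ := h.exists_poly
  -- The polynomial is the homogeneous relation for `p'`: it vanishes wherever `p'` is the value,
  -- and not at `a`, where the relation determines `p`.
  refine ⟨MvPolynomial.C (num p') * Q - MvPolynomial.C (den p') * P, fun h0 => hne (hu _ ?_),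
    fun b hb hx' => hb ?_⟩
  · simpa [sub_eq_zero] using h0
  · simpa [sub_eq_zero] using hx'.num_mul_eval hQ hx

/-- The map `p ↦ r / p` of the projective line, for `r ≠ 0`. -/
def divBy (r : ℂ) (p : P1) : P1 := p.elim ((0 : ℂ) : P1) (fun c => ratio r c)

@[simp] theorem divBy_infPt (r : ℂ) : divBy r infPt = ((0 : ℂ) : P1) := rfl

theorem divBy_coe (r c : ℂ) : divBy r c = ratio r c := rfl

@[simp] theorem divBy_zero (r : ℂ) : divBy r ((0 : ℂ) : P1) = infPt := by simp [divBy_coe, ratio]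

theorem divBy_coe_of_ne {r c : ℂ} (hc : c ≠ 0) : divBy r c = ((r / c : ℂ) : P1) := by
  simp [divBy_coe, ratio, hc]

theorem divBy_divBy {r : ℂ} (hr : r ≠ 0) (p : P1) : divBy r (divBy r p) = p := by
  rcases P1.cases p with rfl | ⟨c, rfl⟩
  · simp
  · by_cases hc : c = 0
    · simp [hc]
    · rw [divBy_coe_of_ne hc, divBy_coe_of_ne (div_ne_zero hr hc), div_div_cancel₀ hr]

theorem divBy_eq_iff {r : ℂ} (hr : r ≠ 0) {p p' : P1} : divBy r p = p' ↔ p = divBy r p' :=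
  ⟨fun h => by rw [← h, divBy_divBy hr], fun h => by rw [h, divBy_divBy hr]⟩

theorem PVal.divBy {x w : RatFun σ} {r : ℂ} {p : P1} (hw : w ≠ 0) (hx : Val a x r) (hr : r ≠ 0)
    (h : PVal a w p) : PVal a (x / w) (divBy r p) := by
  rcases P1.cases p with rfl | ⟨c, rfl⟩
  · rw [divBy_infPt, pval_coe, div_eq_mul_inv]
    simpa using hx.mul h.2
  · by_cases hc : c = 0
    · subst hc
      rw [divBy_zero, pval_infPt]
      refine ⟨div_ne_zero (hx.ne_zero hr) hw, ?_⟩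
      rw [inv_div]
      simpa using Val.div h hx hr
    · rw [divBy_coe_of_ne hc, pval_coe]
      exact hx.div h hc

theorem PVal.inv {w : RatFun σ} {p : P1} (hw : w ≠ 0) (h : PVal a w p) :
    PVal a w⁻¹ (QPVI.divBy 1 p) := by
  simpa using h.divBy hw Val.one one_ne_zero

/-- The map `p ↦ α + β p` of the projective line, for `β ≠ 0`. -/
def affine (α β : ℂ) (p : P1) : P1 := p.elim infPt (fun c => ((α + β * c : ℂ) : P1))

/-- At `p = ∞`, write `x + y w = w (x w⁻¹ + y)`; the second factor has the nonzero value `β`. -/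
theorem PVal.affine {x y w : RatFun σ} {α β : ℂ} {p : P1} (hx : Val a x α) (hy : Val a y β)
    (hβ : β ≠ 0) (h : PVal a w p) : PVal a (x + y * w) (affine α β p) := by
  rcases P1.cases p with rfl | ⟨c, rfl⟩
  · have hw := h.1
    have h1 : Val a (x * w⁻¹ + y) β := by simpa using (hx.mul h.2).add hy
    have h2 : x + y * w = w * (x * w⁻¹ + y) := by field_simp
    refine ⟨h2 ▸ mul_ne_zero hw (h1.ne_zero hβ), ?_⟩
    rw [h2, mul_inv]
    simpa using h.2.mul (h1.inv hβ)
  · exact hx.add (hy.mul h)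

/-- Regular homogeneous coordinates allow polynomial identities between rational functions to be
evaluated without separating finite and infinite values. -/
theorem PVal.exists_homogeneous {x : RatFun σ} {p : P1} (h : PVal a x p) :
    ∃ N M : RatFun σ, Val a N (num p) ∧ Val a M (den p) ∧ M ≠ 0 ∧ x = N / M := by
  rcases P1.cases p with rfl | ⟨c, rfl⟩
  · exact ⟨1, x⁻¹, Val.one, h.2, inv_ne_zero h.1, by simp⟩
  · exact ⟨x, 1, h, Val.one, one_ne_zero, by simp⟩

theorem pval_ratio {N M : RatFun σ} {n m : ℂ} (hN : Val a N n) (hM : Val a M m) (hM0 : M ≠ 0)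
    (h : n ≠ 0 ∨ m ≠ 0) : PVal a (N / M) (ratio n m) := by
  unfold ratio
  split_ifs with hm
  · have hn : n ≠ 0 := h.resolve_right (not_not.2 hm)
    refine ⟨div_ne_zero (hN.ne_zero hn) hM0, ?_⟩
    rw [inv_div]
    simpa [hm] using hM.div hN hn
  · exact hN.div hM hm

end Values

/-! ### Configurations of eight points -/

/-- Labels of the eight blown-up points. -/
inductive CtrIdx : Type
  | e (i : Bool)
  | b (i : Bool)
  | a (i : Bool)
  | k (i : Bool)

/-- The coordinates of eight points `(0, e i)`, `(b i, ∞)`, `(a i, 0)`, `(∞, k i)`. -/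
structure Params (F : Type) where
  e : Bool → F
  b : Bool → F
  a : Bool → F
  k : Bool → F

namespace Params

/-- The eight points. -/
def ctr {F : Type} [Zero F] (D : Params F) : CtrIdx → OnePoint F × OnePoint F
  | .e i => (((0 : F) : OnePoint F), (D.e i : OnePoint F))
  | .b i => ((D.b i : OnePoint F), OnePoint.infty)
  | .a i => ((D.a i : OnePoint F), ((0 : F) : OnePoint F))
  | .k i => (OnePoint.infty, (D.k i : OnePoint F))

/-- The configuration with the two factors of `ℙ¹ × ℙ¹` interchanged. -/
def swap {F : Type} (D : Params F) : Params F := ⟨D.a, D.k, D.e, D.b⟩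

/-- All coordinates are nonzero, and no two of the eight points lie on a common fibre other than
those over `0` and `∞`. -/
structure Good (D : Params ℂ) : Prop where
  e0 : ∀ i, D.e i ≠ 0
  b0 : ∀ i, D.b i ≠ 0
  a0 : ∀ i, D.a i ≠ 0
  k0 : ∀ i, D.k i ≠ 0
  e_inj : ∀ i, D.e i ≠ D.e (!i)
  b_inj : ∀ i, D.b i ≠ D.b (!i)
  a_inj : ∀ i, D.a i ≠ D.a (!i)
  k_inj : ∀ i, D.k i ≠ D.k (!i)
  ab : ∀ i j, D.a i ≠ D.b j
  ek : ∀ i j, D.e i ≠ D.k j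

theorem Good.swap {D : Params ℂ} (h : D.Good) : D.swap.Good :=
  ⟨h.a0, h.k0, h.e0, h.b0, h.a_inj, h.k_inj, h.e_inj, h.b_inj, h.ek, h.ab⟩

theorem eq_of_ne_not {F : Type} {f : Bool → F} (h : ∀ i, f i ≠ f (!i)) {i j : Bool}
    (hij : f i = f j) : i = j := by
  have h1 := h i
  cases i <;> cases j <;> simp_all

theorem Good.ctr_injective {D : Params ℂ} (h : D.Good) : Function.Injective D.ctr := by
  have H : ∀ c : ℂ, (OnePoint.infty : OnePoint ℂ) ≠ c := fun c => OnePoint.infty_ne_coe c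
  have H' : ∀ c : ℂ, (c : OnePoint ℂ) ≠ OnePoint.infty := fun c => OnePoint.coe_ne_infty c
  rintro (i | i | i | i) (j | j | j | j) hij <;>
    simp only [ctr, Prod.mk.injEq, OnePoint.coe_eq_coe, H, H', and_false, false_and, and_true,
      true_and] at hij
  · rw [eq_of_ne_not h.e_inj hij]
  · exact absurd hij.1.symm (h.a0 j)
  · rw [eq_of_ne_not h.b_inj hij]
  · exact absurd hij.1 (h.a0 i)
  · rw [eq_of_ne_not h.a_inj hij]
  · rw [eq_of_ne_not h.k_inj hij]

/-- The function `R(x) = c (x - a₁)(x - a₂) / ((x - b₁)(x - b₂))`. -/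
def rat {F : Type} [Field F] (c : F) (D : Params F) (x : F) : F :=
  c * ((x - D.a true) * (x - D.a false)) / ((x - D.b true) * (x - D.b false))

/-- The value at `p` of the function `R`, away from its poles. -/
def ratP (c : ℂ) (D : Params ℂ) (p : P1) : ℂ := p.elim c (rat c D)

/-- `D'` is the image of `D` under `(x, w) ↦ (x, R(x) / w)`. -/
structure Dual {F : Type} [Field F] (c : F) (D D' : Params F) : Prop where
  a : D'.a = D.a
  b : D'.b = D.b
  -- The image of `e i` is `R(0) / e i`. The labels are flipped because division turns a factor `Θ`
  -- into `Θ⁻¹`.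
  e : ∀ i, D'.e (!i) * D.e i * (D.b true * D.b false) = c * (D.a true * D.a false)
  k : ∀ i, D'.k (!i) * D.k i = c

theorem Dual.symm {F : Type} [Field F] {c : F} {D D' : Params F} (h : Dual c D D') :
    Dual c D' D where
  a := h.a.symm
  b := h.b.symm
  e i := by
    have := h.e (!i)
    rw [Bool.not_not] at this
    rw [h.a, h.b, mul_comm (D.e _), this]
  k i := by
    have := h.k (!i)
    rw [Bool.not_not] at this
    rw [mul_comm, this]

theorem rat_eq {F : Type} [Field F] (c : F) (D : Params F) (x : F) (i j : Bool) :
    rat c D x = c * ((x - D.a i) * (x - D.a (!i))) / ((x - D.b j) * (x - D.b (!j))) := by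
  cases i <;> cases j <;> simp [rat, mul_comm]

end Params

/-- The local coordinate `x - c`, or `1 / x` for `c = ∞`. -/
def locCoord {F : Type} [Field F] (c : OnePoint F) (x : F) : F := c.elim x⁻¹ (fun d => x - d)

@[simp] theorem locCoord_coe {F : Type} [Field F] (c x : F) :
    locCoord (c : OnePoint F) x = x - c := rfl

@[simp] theorem locCoord_infty {F : Type} [Field F] (x : F) :
    locCoord (OnePoint.infty : OnePoint F) x = x⁻¹ := rfl

section

variable {σ : Type}

/-- The configuration of rational functions `E` is regular at `s`, with value `D`. -/
structure ValParams (s : σ → ℂ) (E : Params (RatFun σ)) (D : Params ℂ) : Prop where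
  e : ∀ i, Val s (E.e i) (D.e i)
  b : ∀ i, Val s (E.b i) (D.b i)
  a : ∀ i, Val s (E.a i) (D.a i)
  k : ∀ i, Val s (E.k i) (D.k i)

theorem ValParams.swap {a : σ → ℂ} {E : Params (RatFun σ)} {D : Params ℂ} (h : ValParams a E D) :
    ValParams a E.swap D.swap :=
  ⟨h.a, h.k, h.e, h.b⟩

/-- The pair of rational functions `(y, z)`, viewed as a map to the blow-up in the family of
points `E`, is regular at `a` with the given value. -/
def PtVal (a : σ → ℂ) (E : Params (RatFun σ)) (D : Params ℂ) (y z : RatFun σ)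
    {Γ : Set (P1 × P1)} : BlowUp Γ → Prop
  | .base p _ => PVal a y p.1 ∧ PVal a z p.2
  | .exc γ _ m => PVal a y γ.1 ∧ PVal a z γ.2 ∧
      -- The slope is measured from the moving centre `E.ctr i`, not from its value at `a`: when
      -- time is a variable, the centres vary too.
      ∃ i, D.ctr i = γ ∧ PVal a (locCoord (E.ctr i).2 z / locCoord (E.ctr i).1 y) m

theorem PtVal.down {a : σ → ℂ} {E : Params (RatFun σ)} {D : Params ℂ} {y z : RatFun σ}
    {Γ : Set (P1 × P1)} {ξ : BlowUp Γ} (h : PtVal a E D y z ξ) :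
    PVal a y ξ.down.1 ∧ PVal a z ξ.down.2 := by
  cases ξ with
  | base p hp => exact h
  | exc γ hγ m => exact ⟨h.1, h.2.1⟩

/-- Interchanging the two coordinates. -/
theorem swap_transport {D : Params ℂ} {Γ Γ' : Set (P1 × P1)} (hD : D.Good)
    (hΓ : Γ = Set.range D.ctr) (hΓ' : Γ' = Set.range D.swap.ctr) (ξ : BlowUp Γ) :
    ∃ η : BlowUp Γ', ∀ (a : σ → ℂ) (E : Params (RatFun σ)) (y z : RatFun σ),
      (∀ i, locCoord (E.ctr i).1 y ≠ 0) → (∀ i, locCoord (E.ctr i).2 z ≠ 0) →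
      PtVal a E D y z ξ → PtVal a E.swap D.swap z y η := by
  have key : ∀ i : CtrIdx, ∃ j : CtrIdx, D.swap.ctr j = (D.ctr i).swap ∧
      ∀ E : Params (RatFun σ), E.swap.ctr j = (E.ctr i).swap := by
    rintro (i | i | i | i)
    exacts [⟨.a i, rfl, fun _ => rfl⟩, ⟨.k i, rfl, fun _ => rfl⟩, ⟨.e i, rfl, fun _ => rfl⟩,
      ⟨.b i, rfl, fun _ => rfl⟩]
  have key' : ∀ j : CtrIdx, ∃ i : CtrIdx, D.swap.ctr j = (D.ctr i).swap := by
    rintro (i | i | i | i)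
    exacts [⟨.a i, rfl⟩, ⟨.k i, rfl⟩, ⟨.e i, rfl⟩, ⟨.b i, rfl⟩]
  subst hΓ hΓ'
  cases ξ with
  | base p hp =>
    refine ⟨.base p.swap ?_, fun a E y z _ _ h => ⟨h.2, h.1⟩⟩
    rintro ⟨j, hj⟩
    obtain ⟨i, hi⟩ := key' j
    exact hp ⟨i, Prod.swap_injective (hi.symm.trans hj)⟩
  | exc γ hγ m =>
    obtain ⟨i, rfl⟩ := hγ
    obtain ⟨j, hj, hj'⟩ := key i
    -- Interchanging the coordinates inverts the slope.
    refine ⟨.exc (D.ctr i).swap ⟨j, hj⟩ (divBy 1 m), fun a E y z hy hz h => ?_⟩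
    obtain ⟨h1, h2, i', hi', h3⟩ := h
    obtain rfl := hD.ctr_injective hi'
    refine ⟨h2, h1, j, hj, ?_⟩
    rw [hj', ← inv_div]
    exact h3.inv (div_ne_zero (hz _) (hy _))

/-! ### The half step `(x, w) ↦ (x, R(x) / w)` -/

variable {a : σ → ℂ} {E : Params (RatFun σ)} {D : Params ℂ} {C x : RatFun σ} {c : ℂ}

/-- Numerator and denominator of `R` have equal degree in `x`, so at `∞` a factor `x` cancels from
each linear factor, leaving an expression in `x⁻¹`. -/
theorem val_rat (hE : ValParams a E D) (hC : Val a C c) {p : P1} (hb : ∀ i, p ≠ (D.b i : P1))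
    (hx : PVal a x p) : Val a (Params.rat C E x) (D.ratP c p) := by
  rcases P1.cases p with rfl | ⟨d, rfl⟩
  · obtain ⟨hx0, hx⟩ := hx
    have h1 : ∀ (u : RatFun σ) (v : ℂ), Val a u v → Val a (1 - u * x⁻¹) 1 := fun u v hu => by
      simpa using Val.one.sub (hu.mul hx)
    have h2 : Params.rat C E x = C * ((1 - E.a true * x⁻¹) * (1 - E.a false * x⁻¹)) /
        ((1 - E.b true * x⁻¹) * (1 - E.b false * x⁻¹)) := by
      have h3 : ∀ u : RatFun σ, x - u = x * (1 - u * x⁻¹) := fun u => by field_simp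
      have h4 : ∀ i, 1 - E.b i * x⁻¹ ≠ 0 := fun i => (h1 _ _ (hE.b i)).ne_zero one_ne_zero
      have h5 := h4 true
      have h6 := h4 false
      rw [Params.rat]
      simp only [h3]
      generalize 1 - E.b true * x⁻¹ = u at *
      generalize 1 - E.b false * x⁻¹ = v at *
      field_simp
    rw [h2]
    simpa [Params.ratP, infPt] using (hC.mul ((h1 _ _ (hE.a true)).mul (h1 _ _ (hE.a false)))).div
      ((h1 _ _ (hE.b true)).mul (h1 _ _ (hE.b false))) (by simp)
  · have hb' : ∀ i, d - D.b i ≠ 0 := fun i h => hb i (by rw [sub_eq_zero.1 h])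
    exact (hC.mul ((Val.sub hx (hE.a true)).mul (Val.sub hx (hE.a false)))).div
      ((Val.sub hx (hE.b true)).mul (Val.sub hx (hE.b false)))
      (mul_ne_zero (hb' _) (hb' _))

theorem ratP_ne_zero (hc : c ≠ 0) {p : P1} (ha : ∀ i, p ≠ (D.a i : P1))
    (hb : ∀ i, p ≠ (D.b i : P1)) : D.ratP c p ≠ 0 := by
  rcases P1.cases p with rfl | ⟨d, rfl⟩
  · exact hc
  · have ha' : ∀ i, d - D.a i ≠ 0 := fun i h => ha i (by rw [sub_eq_zero.1 h])
    have hb' : ∀ i, d - D.b i ≠ 0 := fun i h => hb i (by rw [sub_eq_zero.1 h])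
    exact div_ne_zero (mul_ne_zero hc (mul_ne_zero (ha' _) (ha' _)))
      (mul_ne_zero (hb' _) (hb' _))

/-- The function `R` has a simple zero at `a i`. -/
theorem val_rat_div_of_zero (hD : D.Good) (hc : c ≠ 0) (i : Bool) :
    ∃ r : ℂ, r ≠ 0 ∧ ∀ (a : σ → ℂ) (E : Params (RatFun σ)) (C x : RatFun σ), ValParams a E D →
      Val a C c → x ≠ E.a i → Val a x (D.a i) → Val a (Params.rat C E x / (x - E.a i)) r := by
  -- This is the derivative of `R` at `a i`. It depends on `c` and `D` alone, hence can be chosen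
  -- before the functions.
  refine ⟨c * (D.a i - D.a (!i)) / ((D.a i - D.b true) * (D.a i - D.b false)),
    div_ne_zero (mul_ne_zero hc (sub_ne_zero.2 (hD.a_inj i)))
      (mul_ne_zero (sub_ne_zero.2 (hD.ab _ _)) (sub_ne_zero.2 (hD.ab _ _))), ?_⟩
  intro a E C x hE hC hx h
  have h1 : Params.rat C E x / (x - E.a i) =
      C * (x - E.a (!i)) / ((x - E.b true) * (x - E.b false)) := by
    rw [Params.rat_eq C E x i true, Bool.not_true]
    have := sub_ne_zero.2 hx
    field_simp
  rw [h1]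
  exact (hC.mul (h.sub (hE.a _))).div ((h.sub (hE.b _)).mul (h.sub (hE.b _)))
    (mul_ne_zero (sub_ne_zero.2 (hD.ab _ _)) (sub_ne_zero.2 (hD.ab _ _)))

/-- The function `R` has a simple pole at `b i`. -/
theorem val_inv_rat_div_of_pole (hD : D.Good) (hc : c ≠ 0) (i : Bool) :
    ∃ r : ℂ, r ≠ 0 ∧ ∀ (a : σ → ℂ) (E : Params (RatFun σ)) (C x : RatFun σ), ValParams a E D →
      Val a C c → x ≠ E.b i → Val a x (D.b i) →
        Val a ((Params.rat C E x)⁻¹ / (x - E.b i)) r := by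
  have h0 : ∀ j, D.b i - D.a j ≠ 0 := fun j => sub_ne_zero.2 (hD.ab _ _).symm
  refine ⟨(D.b i - D.b (!i)) / (c * ((D.b i - D.a true) * (D.b i - D.a false))),
    div_ne_zero (sub_ne_zero.2 (hD.b_inj i)) (mul_ne_zero hc (mul_ne_zero (h0 _) (h0 _))), ?_⟩
  intro a E C x hE hC hx h
  have h1 : (Params.rat C E x)⁻¹ / (x - E.b i) =
      (x - E.b (!i)) / (C * ((x - E.a true) * (x - E.a false))) := by
    rw [Params.rat_eq C E x true i, Bool.not_true, inv_div]
    have := sub_ne_zero.2 hx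
    field_simp
  rw [h1]
  exact (h.sub (hE.b _)).div (hC.mul ((h.sub (hE.a _)).mul (h.sub (hE.a _))))
    (mul_ne_zero hc (mul_ne_zero (h0 _) (h0 _)))

/-- The derivative of `R` at `0`. -/
theorem val_rat_sub_div_zero (hD : D.Good) :
    ∃ d : ℂ, ∀ (a : σ → ℂ) (E : Params (RatFun σ)) (C x : RatFun σ), ValParams a E D →
      Val a C c → x ≠ 0 → (∀ i, x ≠ E.b i) → Val a x 0 →
        Val a ((Params.rat C E x - Params.rat C E 0) / x) d := by
  -- The redundant zeros reproduce the right-hand side of `h1` with `x` replaced by its value `0`,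
  -- the form in which the calculus of values delivers it.
  refine ⟨c * (0 * (D.b true * D.b false - D.a true * D.a false) -
      (D.a true + D.a false) * (D.b true * D.b false) +
      (D.a true * D.a false) * (D.b true + D.b false)) /
    ((0 - D.b true) * (0 - D.b false) * (D.b true * D.b false)), fun a E C x hE hC hx hb h => ?_⟩
  have h0 : ∀ i, E.b i ≠ 0 := fun i => (hE.b i).ne_zero (hD.b0 i)
  have h1 : (Params.rat C E x - Params.rat C E 0) / x =
      C * (x * (E.b true * E.b false - E.a true * E.a false) -
        (E.a true + E.a false) * (E.b true * E.b false) +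
        (E.a true * E.a false) * (E.b true + E.b false)) /
      ((x - E.b true) * (x - E.b false) * (E.b true * E.b false)) := by
    have h2 := sub_ne_zero.2 (hb true)
    have h3 := sub_ne_zero.2 (hb false)
    have h4 := h0 true
    have h5 := h0 false
    simp only [Params.rat, zero_sub]
    field_simp
    ring
  rw [h1]
  have hat := hE.a true
  have haf := hE.a false
  have hbt := hE.b true
  have hbf := hE.b false
  refine (hC.mul (((h.mul ((hbt.mul hbf).sub (hat.mul haf))).sub
    ((hat.add haf).mul (hbt.mul hbf))).add ((hat.mul haf).mul (hbt.add hbf)))).div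
    (((h.sub hbt).mul (h.sub hbf)).mul (hbt.mul hbf)) ?_
  simp [hD.b0]

/-- The derivative of `R` at `∞`. -/
theorem val_rat_sub_div_infty :
    ∃ d : ℂ, ∀ (a : σ → ℂ) (E : Params (RatFun σ)) (C x : RatFun σ), ValParams a E D →
      Val a C c → x ≠ 0 → (∀ i, x ≠ E.b i) → Val a x⁻¹ 0 →
        Val a ((Params.rat C E x - C) / x⁻¹) d := by
  refine ⟨c * ((D.b true + D.b false - D.a true - D.a false) +
      0 * (D.a true * D.a false - D.b true * D.b false)) /
    ((1 - D.b true * 0) * (1 - D.b false * 0)), fun a E C x hE hC hx hb h => ?_⟩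
  have h1 : (Params.rat C E x - C) / x⁻¹ =
      C * ((E.b true + E.b false - E.a true - E.a false) +
        x⁻¹ * (E.a true * E.a false - E.b true * E.b false)) /
      ((1 - E.b true * x⁻¹) * (1 - E.b false * x⁻¹)) := by
    have h2 := sub_ne_zero.2 (hb true)
    have h3 := sub_ne_zero.2 (hb false)
    have h4 : ∀ u, 1 - u * x⁻¹ = (x - u) / x := fun u => by field_simp
    simp only [Params.rat, h4]
    field_simp
    ring
  rw [h1]
  have hat := hE.a true
  have haf := hE.a false
  have hbt := hE.b true
  have hbf := hE.b false
  refine (hC.mul ((((hbt.add hbf).sub hat).sub haf).add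
    (h.mul ((hat.mul haf).sub (hbt.mul hbf))))).div
    ((Val.one.sub (hbt.mul h)).mul (Val.one.sub (hbf.mul h))) ?_
  simp

/-- The effect of `w ↦ S / w` on tangent directions, in a fibre on which it is invertible. -/
theorem pval_slope {S S0 u w e : RatFun σ} {r d v : ℂ} {m : P1} (hw : w ≠ 0)
    (hS0 : Val a S0 r) (hr : r ≠ 0) (hd : Val a ((S - S0) / u) d) (hwv : Val a w v)
    (he : Val a e v) (hv : v ≠ 0) (hu : u ≠ 0) (h : PVal a ((w - e) / u) m) :
    PVal a ((S / w - S0 / e) / u) (affine (d / v) (-(r / (v * v))) m) := by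
  have he0 := he.ne_zero hv
  -- A difference form of the quotient rule: the new slope is affine in the old one, with linear
  -- coefficient `-(r / v²)`, the derivative of `r / w` at `w = v`.
  have h1 : (S / w - S0 / e) / u = (S - S0) / u / w + -(S0 / (w * e)) * ((w - e) / u) := by
    field_simp
    ring
  rw [h1]
  exact h.affine (hd.div hwv hv) (hS0.div (hwv.mul he) (mul_ne_zero hv hv)).neg
    (neg_ne_zero.2 (div_ne_zero hr (mul_ne_zero hv hv)))

end

theorem ratP_zero_eq {D D' : Params ℂ} {c : ℂ} (hD : D.Good) (hD' : Params.Dual c D D')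
    (i : Bool) : D.ratP c ((0 : ℂ) : P1) / D.e i = D'.e (!i) := by
  have h := hD'.e i
  have h1 := hD.e0 i
  have h2 := hD.b0 true
  have h3 := hD.b0 false
  rw [div_eq_iff h1]
  change c * ((0 - D.a true) * (0 - D.a false)) / ((0 - D.b true) * (0 - D.b false)) = _
  rw [zero_sub, zero_sub, zero_sub, zero_sub, neg_mul_neg, neg_mul_neg, ← h,
    mul_div_cancel_right₀ _ (mul_ne_zero h2 h3)]

theorem rat_zero_div {σ : Type} {a : σ → ℂ} {E E' : Params (RatFun σ)} {D : Params ℂ}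
    {C : RatFun σ} (hD : D.Good) (hE : ValParams a E D) (hE' : Params.Dual C E E') (i : Bool) :
    Params.rat C E 0 / E.e i = E'.e (!i) := by
  have h := hE'.e i
  have h1 := (hE.e i).ne_zero (hD.e0 i)
  have h2 := (hE.b true).ne_zero (hD.b0 true)
  have h3 := (hE.b false).ne_zero (hD.b0 false)
  rw [div_eq_iff h1, Params.rat, zero_sub, zero_sub, zero_sub, zero_sub, neg_mul_neg, neg_mul_neg,
    ← h, mul_div_cancel_right₀ _ (mul_ne_zero h2 h3)]

/-- Away from the fibres over `a i` and `b i`, division into `R(x)` is its own inverse on the fibre,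
and it matches the centres over `0` and `∞` with the dual ones. -/
theorem base_not_mem_dual {D D' : Params ℂ} {c : ℂ} (hD : D.Good) (hc : c ≠ 0)
    (hD' : Params.Dual c D D') {p : P1 × P1} (hp : p ∉ Set.range D.ctr)
    (ha : ∀ i, p.1 ≠ (D.a i : P1)) (hb : ∀ i, p.1 ≠ (D.b i : P1)) :
    (p.1, divBy (D.ratP c p.1) p.2) ∉ Set.range D'.ctr := by
  have hr := ratP_ne_zero hc ha hb
  rintro ⟨i | i | i | i, h⟩
  · obtain ⟨h1, h2⟩ := Prod.mk.inj h
    apply hp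
    refine ⟨.e (!i), Prod.ext h1 ?_⟩
    have h4 := ratP_zero_eq hD hD' (!i)
    rw [Bool.not_not, h1] at h4
    rw [eq_comm, divBy_eq_iff hr, ← h4,
      divBy_coe_of_ne (div_ne_zero hr (hD.e0 _)), div_div_cancel₀ hr] at h2
    exact h2.symm
  · exact hb i (by rw [← hD'.b]; exact (Prod.mk.inj h).1.symm)
  · exact ha i (by rw [← hD'.a]; exact (Prod.mk.inj h).1.symm)
  · obtain ⟨h1, h2⟩ := Prod.mk.inj h
    apply hp
    refine ⟨.k (!i), Prod.ext h1 ?_⟩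
    have h4 := hD'.k (!i)
    rw [Bool.not_not] at h4
    have h5 : D.ratP c p.1 = c := by rw [← h1]; rfl
    have h6 : D'.k i ≠ 0 := by
      intro h0
      rw [h0, zero_mul] at h4
      exact hc h4.symm
    rw [eq_comm, divBy_eq_iff hr, h5, divBy_coe_of_ne h6, ← h4, mul_div_cancel_left₀ _ h6] at h2
    exact h2.symm

/-- The half step `(x, w) ↦ (x, R(x) / w)` is a well-defined map of blow-ups. -/
theorem half_transport {σ : Type} {D D' : Params ℂ} {c : ℂ} {Γ Γ' : Set (P1 × P1)} (hD : D.Good)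
    (hc : c ≠ 0) (hD' : Params.Dual c D D') (hΓ : Γ = Set.range D.ctr)
    (hΓ' : Γ' = Set.range D'.ctr) (ξ : BlowUp Γ) :
    ∃ η : BlowUp Γ', ∀ (s : σ → ℂ) (E E' : Params (RatFun σ)) (C x w : RatFun σ),
      ValParams s E D → Params.Dual C E E' → Val s C c → x ≠ 0 → (∀ i, x ≠ E.a i) →
      (∀ i, x ≠ E.b i) → w ≠ 0 → PtVal s E D x w ξ →
      PtVal s E' D' x (Params.rat C E x / w) η := by
  subst hΓ hΓ'
  have hnai : ∀ i, OnePoint.infty ≠ (D.a i : P1) := fun i => OnePoint.infty_ne_coe _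
  have hnbi : ∀ i, OnePoint.infty ≠ (D.b i : P1) := fun i => OnePoint.infty_ne_coe _
  have hna0 : ∀ i, ((0 : ℂ) : P1) ≠ (D.a i : P1) := fun i h =>
    hD.a0 i (OnePoint.coe_eq_coe.1 h).symm
  have hnb0 : ∀ i, ((0 : ℂ) : P1) ≠ (D.b i : P1) := fun i h =>
    hD.b0 i (OnePoint.coe_eq_coe.1 h).symm
  have hmem : ∀ i, D'.ctr i ∈ Set.range D'.ctr := fun i => ⟨i, rfl⟩
  have hca : ∀ i, D'.ctr (.a i) = ((D.a i : P1), ((0 : ℂ) : P1)) := fun i => by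
    rw [← hD'.a]; rfl
  have hcb : ∀ i, D'.ctr (.b i) = ((D.b i : P1), infPt) := fun i => by
    rw [← hD'.b]; rfl
  -- By nondegeneracy the only centre over `a i` is `(a i, 0)`, and in `hneI` the only one over `b
  -- i` is `(b i, ∞)`.
  have hne0 : ∀ m : P1, m ≠ ((0 : ℂ) : P1) → ∀ i, ((D.a i : P1), m) ∉ Set.range D'.ctr := by
    rintro m hm i ⟨j | j | j | j, h⟩
    · exact hna0 i (Prod.mk.inj h).1
    · have := (Prod.mk.inj h).1
      rw [hD'.b] at this
      exact hD.ab _ _ (OnePoint.coe_eq_coe.1 this).symm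
    · exact hm (Prod.mk.inj h).2.symm
    · exact OnePoint.infty_ne_coe _ (Prod.mk.inj h).1
  have hneI : ∀ m : P1, m ≠ infPt → ∀ i, ((D.b i : P1), m) ∉ Set.range D'.ctr := by
    rintro m hm i ⟨j | j | j | j, h⟩
    · exact hnb0 i (Prod.mk.inj h).1
    · exact hm (Prod.mk.inj h).2.symm
    · have := (Prod.mk.inj h).1
      rw [hD'.a] at this
      exact hD.ab _ _ (OnePoint.coe_eq_coe.1 this)
    · exact OnePoint.infty_ne_coe _ (Prod.mk.inj h).1
  have hSa : ∀ (s : σ → ℂ) (E : Params (RatFun σ)) (C x : RatFun σ) (i : Bool), ValParams s E D →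
      Val s C c → Val s x (D.a i) → Val s (Params.rat C E x) 0 := by
    intro s E C x i hE hC hx
    have h := val_rat (p := (D.a i : P1)) hE hC
      (fun j h => hD.ab _ _ (OnePoint.coe_eq_coe.1 h)) hx
    have h2 : D.ratP c (D.a i : P1) = 0 := by
      change Params.rat c D (D.a i) = 0
      rw [Params.rat_eq c D _ i true]
      simp
    rwa [h2] at h
  have hR0 : ∀ (E : Params (RatFun σ)) (C x : RatFun σ) (s : σ → ℂ), ValParams s E D →
      Val s C c → x ≠ 0 → (∀ i, x ≠ E.a i) → (∀ i, x ≠ E.b i) → Params.rat C E x ≠ 0 :=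
    fun E C x s _ hC _ ha hb => div_ne_zero
      (mul_ne_zero (hC.ne_zero hc) (mul_ne_zero (sub_ne_zero.2 (ha _)) (sub_ne_zero.2 (ha _))))
      (mul_ne_zero (sub_ne_zero.2 (hb _)) (sub_ne_zero.2 (hb _)))
  cases ξ with
  | base p hp =>
    by_cases hpa : ∃ i, p.1 = (D.a i : P1)
    · obtain ⟨i, hi⟩ := hpa
      obtain ⟨r, hr, H⟩ := val_rat_div_of_zero (σ := σ) hD hc i
      have hp2 : p.2 ≠ ((0 : ℂ) : P1) := fun h => hp ⟨.a i, (Prod.ext hi h).symm⟩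
      -- The fibre over `a i` becomes the exceptional curve: the new slope is `(R(x) / (x - a i)) /
      -- w`, and its first factor has value `r`.
      refine ⟨.exc (D'.ctr (.a i)) (hmem _) (divBy r p.2), ?_⟩
      intro s E E' C x w hE hE' hC hx0 hxa hxb hw ⟨hx, hwp⟩
      rw [hi] at hx
      have h1 := H s E C x hE hC (hxa i) hx
      have h2 : PVal s ((Params.rat C E x / (x - E.a i)) / w) (divBy r p.2) := hwp.divBy hw h1 hr
      have h3 : Val s (Params.rat C E x / w) 0 := by
        have h4 := hwp.inv hw
        obtain h5 | ⟨v, hv⟩ := P1.cases (divBy 1 p.2)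
        · rw [divBy_eq_iff one_ne_zero, divBy_infPt] at h5
          exact absurd h5 hp2
        · rw [hv] at h4
          simpa [div_eq_mul_inv] using (hSa s E C x i hE hC hx).mul h4
      rw [PtVal, hca]
      refine ⟨hx, h3, .a i, hca i, ?_⟩
      simp only [Params.ctr, locCoord_coe, sub_zero, hE'.a]
      rwa [div_right_comm]
    · by_cases hpb : ∃ i, p.1 = (D.b i : P1)
      · obtain ⟨i, hi⟩ := hpb
        obtain ⟨r, hr, H⟩ := val_inv_rat_div_of_pole (σ := σ) hD hc i
        have hp2 : p.2 ≠ infPt := fun h => hp ⟨.b i, (Prod.ext hi h).symm⟩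
        -- Here the slope is taken in the coordinate `1 / w` at `∞`; it equals `(R(x)⁻¹ / (x - b i))
        -- · w`, with value `r · p.2`.
        refine ⟨.exc (D'.ctr (.b i)) (hmem _) (divBy r (divBy 1 p.2)), ?_⟩
        intro s E E' C x w hE hE' hC hx0 hxa hxb hw ⟨hx, hwp⟩
        rw [hi] at hx
        have h1 := H s E C x hE hC (hxb i) hx
        have h2 := (hwp.inv hw).divBy (inv_ne_zero hw) h1 hr
        have hxi : x - E.b i ≠ 0 := sub_ne_zero.2 (hxb i)
        have h3 : PVal s (Params.rat C E x / w) infPt := by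
          refine ⟨div_ne_zero (hR0 E C x s hE hC hx0 hxa hxb) hw, ?_⟩
          obtain h5 | ⟨v, hv⟩ := P1.cases p.2
          · exact absurd h5 hp2
          · rw [hv] at hwp
            have h6 : (Params.rat C E x / w)⁻¹ =
                (Params.rat C E x)⁻¹ / (x - E.b i) * (x - E.b i) * w := by
              field_simp
            rw [h6]
            simpa using (h1.mul (Val.sub hx (hE.b i))).mul hwp
        rw [PtVal, hcb]
        refine ⟨hx, h3, .b i, hcb i, ?_⟩
        simp only [Params.ctr, locCoord_coe, locCoord_infty, hE'.b]
        convert h2 using 1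
        field_simp
      · push Not at hpa hpb
        refine ⟨.base _ (base_not_mem_dual hD hc hD' hp hpa hpb), ?_⟩
        intro s E E' C x w hE hE' hC hx0 hxa hxb hw ⟨hx, hwp⟩
        exact ⟨hx, hwp.divBy hw (val_rat hE hC hpb hx) (ratP_ne_zero hc hpa hpb)⟩
  | exc γ hγ m =>
    obtain ⟨i | i | i | i, rfl⟩ := hγ
    · obtain ⟨d, hd⟩ := val_rat_sub_div_zero (σ := σ) (c := c) hD
      have hr := ratP_ne_zero hc hna0 hnb0
      -- `R` is finite and nonzero at `0`, so the half step is a local isomorphism there and acts on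
      -- directions through its differential, as in `pval_slope`.
      refine ⟨.exc _ (hmem (.e (!i))) (affine (d / D.e i)
        (-(D.ratP c ((0 : ℂ) : P1) / (D.e i * D.e i))) m), ?_⟩
      intro s E E' C x w hE hE' hC hx0 hxa hxb hw ⟨hx, hwp, j, hj, hm⟩
      obtain rfl := hD.ctr_injective hj
      simp only [Params.ctr, locCoord_coe, sub_zero] at hm
      have hx' : Val s x 0 := hx
      have hw' : Val s w (D.e i) := hwp
      refine ⟨hx, ?_, _, rfl, ?_⟩
      · have := (val_rat (p := ((0 : ℂ) : P1)) hE hC hnb0 hx').div hw' (hD.e0 i)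
        rwa [ratP_zero_eq hD hD'] at this
      · simp only [Params.ctr, locCoord_coe, sub_zero]
        rw [← rat_zero_div hD hE hE']
        exact pval_slope hw (val_rat (p := ((0 : ℂ) : P1)) hE hC hnb0 Val.zero) hr
          (hd s E C x hE hC hx0 hxb hx') hw' (hE.e i) (hD.e0 i) hx0 hm
    · obtain ⟨r, hr, H⟩ := val_inv_rat_div_of_pole (σ := σ) hD hc i
      -- Slope `∞` is the direction of the fibre, where the exceptional curve meets its strict
      -- transform; that point goes to the corresponding intersection. Every other direction `m`
      -- goes to the point `m / r` of the fibre, which is no centre.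
      by_cases hm0 : m = infPt
      · refine ⟨.exc (D'.ctr (.b i)) (hmem _) infPt, ?_⟩
        intro s E E' C x w hE hE' hC hx0 hxa hxb hw ⟨hx, hwp, j, hj, hm⟩
        obtain rfl := hD.ctr_injective hj
        simp only [Params.ctr, locCoord_coe, locCoord_infty] at hm
        have h1 := H s E C x hE hC (hxb i) hx
        have hxi : x - E.b i ≠ 0 := sub_ne_zero.2 (hxb i)
        rw [PtVal, hcb]
        refine ⟨hx, ?_, .b i, hcb i, ?_⟩
        · have h2 := (hm.divBy (div_ne_zero (inv_ne_zero hw) hxi) h1 hr).inv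
            (div_ne_zero (div_ne_zero (inv_ne_zero (hR0 E C x s hE hC hx0 hxa hxb)) hxi)
              (div_ne_zero (inv_ne_zero hw) hxi))
          rw [hm0, divBy_infPt, divBy_zero] at h2
          convert h2 using 1
          field_simp
        · simp only [Params.ctr, locCoord_coe, locCoord_infty, hE'.b]
          have h2 := PVal.divBy (p := ((0 : ℂ) : P1)) (inv_ne_zero hw) h1 hr hwp.2
          rw [divBy_zero] at h2
          convert h2 using 1
          field_simp
      · refine ⟨.base _ (hneI (divBy 1 (divBy r m)) (fun h => hm0 ?_) i), ?_⟩
        · rw [divBy_eq_iff one_ne_zero, divBy_infPt, divBy_eq_iff hr, divBy_zero] at h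
          exact h
        intro s E E' C x w hE hE' hC hx0 hxa hxb hw ⟨hx, hwp, j, hj, hm⟩
        obtain rfl := hD.ctr_injective hj
        simp only [Params.ctr, locCoord_coe, locCoord_infty] at hm
        have h1 := H s E C x hE hC (hxb i) hx
        have hxi : x - E.b i ≠ 0 := sub_ne_zero.2 (hxb i)
        have h2 := (hm.divBy (div_ne_zero (inv_ne_zero hw) hxi) h1 hr).inv
          (div_ne_zero (div_ne_zero (inv_ne_zero (hR0 E C x s hE hC hx0 hxa hxb)) hxi)
            (div_ne_zero (inv_ne_zero hw) hxi))
        refine ⟨hx, ?_⟩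
        convert h2 using 1
        field_simp
    · obtain ⟨r, hr, H⟩ := val_rat_div_of_zero (σ := σ) hD hc i
      -- As over `b i`: the fibre direction is preserved, and any other slope `m` goes to the point
      -- `r / m` of the fibre.
      by_cases hm0 : m = infPt
      · refine ⟨.exc (D'.ctr (.a i)) (hmem _) infPt, ?_⟩
        intro s E E' C x w hE hE' hC hx0 hxa hxb hw ⟨hx, hwp, j, hj, hm⟩
        obtain rfl := hD.ctr_injective hj
        simp only [Params.ctr, locCoord_coe, sub_zero] at hm
        have h1 := H s E C x hE hC (hxa i) hx
        have hxi : x - E.a i ≠ 0 := sub_ne_zero.2 (hxa i)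
        rw [PtVal, hca]
        refine ⟨hx, ?_, .a i, hca i, ?_⟩
        · have h2 := hm.divBy (div_ne_zero hw hxi) h1 hr
          rw [hm0, divBy_infPt] at h2
          convert h2 using 1
          field_simp
        · simp only [Params.ctr, locCoord_coe, sub_zero, hE'.a]
          have h2 := PVal.divBy hw h1 hr hwp
          rw [Params.ctr, divBy_zero] at h2
          rwa [div_right_comm]
      · refine ⟨.base _ (hne0 (divBy r m) (fun h => hm0 ?_) i), ?_⟩
        · rwa [divBy_eq_iff hr, divBy_zero] at h
        intro s E E' C x w hE hE' hC hx0 hxa hxb hw ⟨hx, hwp, j, hj, hm⟩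
        obtain rfl := hD.ctr_injective hj
        simp only [Params.ctr, locCoord_coe, sub_zero] at hm
        have h1 := H s E C x hE hC (hxa i) hx
        have hxi : x - E.a i ≠ 0 := sub_ne_zero.2 (hxa i)
        have h2 := hm.divBy (div_ne_zero hw hxi) h1 hr
        refine ⟨hx, ?_⟩
        convert h2 using 1
        field_simp
    · obtain ⟨d, hd⟩ := val_rat_sub_div_infty (σ := σ) (c := c) (D := D)
      refine ⟨.exc _ (hmem (.k (!i))) (affine (d / D.k i) (-(c / (D.k i * D.k i))) m), ?_⟩
      intro s E E' C x w hE hE' hC hx0 hxa hxb hw ⟨hx, hwp, j, hj, hm⟩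
      obtain rfl := hD.ctr_injective hj
      simp only [Params.ctr, locCoord_coe, locCoord_infty] at hm
      have hw' : Val s w (D.k i) := hwp
      have hk : c / D.k i = D'.k (!i) := by rw [div_eq_iff (hD.k0 i), hD'.k]
      have hk' : C / E.k i = E'.k (!i) := by
        rw [div_eq_iff ((hE.k i).ne_zero (hD.k0 i)), hE'.k]
      refine ⟨hx, ?_, _, rfl, ?_⟩
      · have := (val_rat (p := infPt) hE hC hnbi hx).div hw' (hD.k0 i)
        rwa [show D.ratP c infPt = c from rfl, hk] at this
      · simp only [Params.ctr, locCoord_coe, locCoord_infty]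
        rw [← hk']
        exact pval_slope hw hC hc (hd s E C x hE hC hx0 hxb hx.2) hw' (hE.k i) (hD.k0 i)
          (inv_ne_zero hx0) hm

/-! ### Generic pairs -/

/-- `y` and `z` generate the field over `k`. -/
def Generates {K : Type} [Field K] [Algebra ℂ K] (k : IntermediateField ℂ K) (y z : K) : Prop :=
  ∀ L : IntermediateField ℂ K, k ≤ L → y ∈ L → z ∈ L → L = ⊤

/-- The field is not generated over `k` by a single element. -/
def NotSimple {K : Type} [Field K] [Algebra ℂ K] (k : IntermediateField ℂ K) : Prop :=
  ∀ z : K, ∃ L : IntermediateField ℂ K, k ≤ L ∧ z ∈ L ∧ L ≠ ⊤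

/-- All coordinates lie in `k`. -/
structure Params.Mem {K : Type} [Field K] [Algebra ℂ K] (E : Params K)
    (k : IntermediateField ℂ K) : Prop where
  e : ∀ i, E.e i ∈ k
  b : ∀ i, E.b i ∈ k
  a : ∀ i, E.a i ∈ k
  k : ∀ i, E.k i ∈ k

section

variable {K : Type} [Field K] [Algebra ℂ K] {k : IntermediateField ℂ K} {y z : K} {E : Params K}

theorem Params.Mem.swap (h : E.Mem k) : E.swap.Mem k := ⟨h.a, h.k, h.e, h.b⟩

theorem Params.Mem.rat_mem (h : E.Mem k) {C : K} (hC : C ∈ k) (hy : y ∈ k) :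
    Params.rat C E y ∈ k :=
  div_mem (mul_mem hC (mul_mem (sub_mem hy (h.a _)) (sub_mem hy (h.a _))))
    (mul_mem (sub_mem hy (h.b _)) (sub_mem hy (h.b _)))

theorem Params.Mem.mono (h : E.Mem k) {L : IntermediateField ℂ K} (hL : k ≤ L) : E.Mem L :=
  ⟨fun i => hL (h.e i), fun i => hL (h.b i), fun i => hL (h.a i), fun i => hL (h.k i)⟩

theorem Generates.symm (h : Generates k y z) : Generates k z y :=
  fun L hL hz hy => h L hL hy hz

/-- If `y` were in `k`, then `z` alone would generate the field over `k`. Consequently `y` differs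
from every centre coordinate, and the divisions in the half steps are legitimate. -/
theorem Generates.not_mem (hk : NotSimple k) (h : Generates k y z) : y ∉ k := by
  intro hy
  obtain ⟨L, hL, hz, hne⟩ := hk z
  exact hne (h L hL (hL hy) hz)

theorem Generates.ne (hk : NotSimple k) (h : Generates k y z) {u : K} (hu : u ∈ k) : y ≠ u :=
  fun he => h.not_mem hk (he ▸ hu)

theorem Generates.ne_zero (hk : NotSimple k) (h : Generates k y z) : y ≠ 0 :=
  h.ne hk (zero_mem k)

theorem Generates.rat_ne_zero (hk : NotSimple k) (h : Generates k y z) (hE : E.Mem k) {C : K}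
    (hC0 : C ≠ 0) : Params.rat C E y ≠ 0 :=
  div_ne_zero
    (mul_ne_zero hC0 (mul_ne_zero (sub_ne_zero.2 (h.ne hk (hE.a _)))
      (sub_ne_zero.2 (h.ne hk (hE.a _)))))
    (mul_ne_zero (sub_ne_zero.2 (h.ne hk (hE.b _))) (sub_ne_zero.2 (h.ne hk (hE.b _))))

/-- The second member can be recovered as `z = R(y) / (R(y) / z)`. -/
theorem Generates.half (hk : NotSimple k) (h : Generates k y z) (hE : E.Mem k) {C : K} (hC : C ∈ k)
    (hC0 : C ≠ 0) : Generates k y (Params.rat C E y / z) := by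
  intro L hL hy hz
  refine h L hL hy ?_
  rw [← div_div_cancel₀ (h.rat_ne_zero hk hE hC0) (b := z)]
  exact div_mem ((hE.mono hL).rat_mem (hL hC) hy) hz

theorem Generates.locCoord_ctr_fst_ne_zero (hk : NotSimple k) (h : Generates k y z)
    (hE : E.Mem k) (i : CtrIdx) : locCoord (E.ctr i).1 y ≠ 0 := by
  rcases i with i | i | i | i
  · exact sub_ne_zero.2 (h.ne_zero hk)
  · exact sub_ne_zero.2 (h.ne hk (hE.b i))
  · exact sub_ne_zero.2 (h.ne hk (hE.a i))
  · exact inv_ne_zero (h.ne_zero hk)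

theorem Generates.locCoord_ctr_snd_ne_zero (hk : NotSimple k) (h : Generates k y z)
    (hE : E.Mem k) (i : CtrIdx) : locCoord (E.ctr i).2 z ≠ 0 := by
  rcases i with i | i | i | i
  · exact sub_ne_zero.2 (h.symm.ne hk (hE.e i))
  · exact inv_ne_zero (h.symm.ne_zero hk)
  · exact sub_ne_zero.2 (h.symm.ne_zero hk)
  · exact sub_ne_zero.2 (h.symm.ne hk (hE.k i))

end

/-! ### Transcendence degree and generic pairs. -/

/-- If `s` generated the field, the field would be algebraic over the algebra generated by `s`, so
its transcendence degree would be at most the cardinality of `s`; but it contains `n` independent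
variables. -/
theorem adjoin_ne_top_of_card_lt {n : ℕ} {s : Set (RatFun (Fin n))}
    (hs : Cardinal.mk s < (n : Cardinal)) : IntermediateField.adjoin ℂ s ≠ ⊤ := by
  intro h
  have halg : Algebra.IsAlgebraic (Algebra.adjoin ℂ s) (RatFun (Fin n)) := by
    refine ⟨fun x => ?_⟩
    have hx : x ∈ IntermediateField.adjoin ℂ s := by rw [h]; trivial
    obtain ⟨u, hu, v, hv, rfl⟩ := IntermediateField.mem_adjoin_iff_div.1 hx
    exact (isAlgebraic_algebraMap (⟨u, hu⟩ : Algebra.adjoin ℂ s)).mul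
      ((isAlgebraic_algebraMap (⟨v, hv⟩ : Algebra.adjoin ℂ s)).inv)
  have h1 := Algebra.IsAlgebraic.trdeg_le_cardinalMk (R := ℂ) (A := RatFun (Fin n)) s
  have h2 := trdeg_le_of_injective
    (IsScalarTower.toAlgHom ℂ (MvPolynomial (Fin n) ℂ) (RatFun (Fin n)))
    (IsFractionRing.injective _ _)
  rw [MvPolynomial.trdeg_of_isDomain] at h2
  simp only [Cardinal.mk_fin, Cardinal.lift_natCast] at h2
  exact absurd (h2.trans h1) (not_le.2 hs)

theorem eq_top_of_X_mem {n : ℕ} {L : IntermediateField ℂ (RatFun (Fin n))}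
    (h : ∀ i, ofPoly (MvPolynomial.X i) ∈ L) : L = ⊤ := by
  rw [eq_top_iff]
  rintro x -
  have hp : ∀ P : MvPolynomial (Fin n) ℂ, ofPoly P ∈ L := by
    intro P
    induction P using MvPolynomial.induction_on with
    | C c =>
      rw [ofPoly, ← MvPolynomial.algebraMap_eq, ← IsScalarTower.algebraMap_apply]
      exact L.algebraMap_mem c
    | add p q hp hq => simpa only [ofPoly, map_add] using add_mem hp hq
    | mul_X p i hp => simpa only [ofPoly, map_mul] using mul_mem hp (h i)
  obtain ⟨P, Q, -, rfl⟩ := IsFractionRing.div_surjective (A := MvPolynomial (Fin n) ℂ) x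
  exact div_mem (hp P) (hp Q)

theorem notSimple_bot : NotSimple (⊥ : IntermediateField ℂ (RatFun (Fin 2))) := by
  intro z
  refine ⟨IntermediateField.adjoin ℂ {z}, bot_le, IntermediateField.subset_adjoin ℂ _ rfl,
    adjoin_ne_top_of_card_lt ?_⟩
  rw [Cardinal.mk_singleton]
  norm_num

theorem notSimple_adjoin (t : RatFun (Fin 3)) : NotSimple (IntermediateField.adjoin ℂ {t}) := by
  intro z
  refine ⟨IntermediateField.adjoin ℂ {t, z}, IntermediateField.adjoin.mono _ _ _ (by simp),
    IntermediateField.subset_adjoin ℂ _ (by simp), adjoin_ne_top_of_card_lt ?_⟩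
  refine lt_of_le_of_lt (Cardinal.mk_insert_le) ?_
  rw [Cardinal.mk_singleton]
  norm_num

/-! ### The configurations of the `q`-Painlevé VI equation -/

section

variable {F : Type} [Field F] [Algebra ℂ F] (q : ℂ) (S : Spectral) (T : F)

/-- The critical points at time `T`. -/
def surfParams : Params F where
  e i := T * algebraMap ℂ F (bif i then S.Θ0 else S.Θ0⁻¹) / algebraMap ℂ F q
  b i := algebraMap ℂ F (bif i then S.Θ1 else S.Θ1⁻¹)
  a i := T * algebraMap ℂ F (bif i then S.Θt else S.Θt⁻¹)
  k i := algebraMap ℂ F (bif i then S.Θinf⁻¹ else S.Θinf / q)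

/-- The points blown up in the surface between the two half steps at time `T`. -/
def midParams : Params F where
  e i := T * algebraMap ℂ F (bif i then S.Θ0 else S.Θ0⁻¹)
  b i := algebraMap ℂ F (bif i then S.Θ1 else S.Θ1⁻¹)
  a i := T * algebraMap ℂ F (bif i then S.Θt else S.Θt⁻¹)
  k i := algebraMap ℂ F (bif i then S.Θinf⁻¹ else S.Θinf / q)

end

theorem centers_eq_range (q : ℂ) (S : Spectral) (t : ℂ) :
    centers q S t = Set.range (surfParams q S t).ctr := by
  ext p
  constructor
  · rintro (rfl | rfl | rfl | rfl | rfl | rfl | rfl | rfl)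
    exacts [⟨.e true, rfl⟩, ⟨.e false, rfl⟩, ⟨.b false, rfl⟩, ⟨.b true, rfl⟩, ⟨.a true, rfl⟩,
      ⟨.a false, rfl⟩, ⟨.k true, rfl⟩, ⟨.k false, rfl⟩]
  · rintro ⟨i | i | i | i, rfl⟩ <;> cases i <;>
      simp [centers, surfParams, Params.ctr, infPt]

/-- The standing assumptions on the parameters. -/
structure Admissible (q : ℂ) (S : Spectral) : Prop where
  q0 : q ≠ 0
  h0 : S.Θ0 ≠ 0
  h1 : S.Θ1 ≠ 0
  ht : S.Θt ≠ 0
  hinf : S.Θinf ≠ 0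
  h0' : S.Θ0 ^ 2 ≠ 1
  h1' : S.Θ1 ^ 2 ≠ 1
  ht' : S.Θt ^ 2 ≠ 1
  hinf' : S.Θinf ^ 2 ≠ q

/-- The times at which the surface is defined. -/
def GoodTime (q : ℂ) (S : Spectral) (t : ℂ) : Prop := t ≠ 0 ∧ t ∉ excludedTimes q S

/-! ### Nondegeneracy and duality of the configurations. -/

section

variable {q : ℂ} {S : Spectral}

/-- The excluded set is stable under multiplication by powers of `q`, so the whole orbit of a good
time is good. -/
theorem GoodTime.zpow_mul (h : Admissible q S) {t : ℂ} (ht : GoodTime q S t) (l : ℤ) :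
    GoodTime q S (q ^ l * t) := by
  refine ⟨mul_ne_zero (zpow_ne_zero _ h.q0) ht.1, ?_⟩
  rintro ⟨ε, hε, δ, hδ, n, hn⟩
  refine ht.2 ⟨ε, hε, δ, hδ, n - l, ?_⟩
  have hql := zpow_ne_zero l h.q0
  have key : ∀ u v : ℂ, q ^ l * t = u * v * q ^ n → t = u * v * q ^ (n - l) := by
    intro u v huv
    rw [zpow_sub₀ h.q0, mul_div_assoc', eq_div_iff hql, ← huv, mul_comm]
  exact hn.imp (key _ _) (key _ _)

theorem GoodTime.mul (h : Admissible q S) {t : ℂ} (ht : GoodTime q S t) :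
    GoodTime q S (q * t) := by
  simpa using ht.zpow_mul h 1

theorem ne_inv_of_sq_ne_one {u : ℂ} (hu : u ^ 2 ≠ 1) (h0 : u ≠ 0) : u ≠ u⁻¹ := by
  intro h
  apply hu
  rw [pow_two]
  nth_rw 2 [h]
  exact mul_inv_cancel₀ h0

theorem GoodTime.ab (h : Admissible q S) {t : ℂ} (ht : GoodTime q S t) (i j : Bool) :
    t * (bif i then S.Θt else S.Θt⁻¹) ≠ bif j then S.Θ1 else S.Θ1⁻¹ := by
  intro he
  refine ht.2 ⟨bif j then 1 else -1, by cases j <;> simp, bif i then -1 else 1,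
    by cases i <;> simp, 0, Or.inl ?_⟩
  have := h.ht
  cases i <;> cases j <;> simp at he ⊢ <;> rw [← he] <;> field_simp

/-- The exponent `n = 0` serves `midParams`, and `n = -1` serves `surfParams`, whose points over `0`
carry an extra factor `1 / q`. -/
theorem GoodTime.ek (h : Admissible q S) {t : ℂ} (ht : GoodTime q S t) (n : ℤ) (i j : Bool) :
    t * (bif i then S.Θ0 else S.Θ0⁻¹) * q ^ n ≠ bif j then S.Θinf⁻¹ else S.Θinf / q := by
  intro he
  refine ht.2 ⟨bif i then -1 else 1, by cases i <;> simp, bif j then -1 else 1,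
    by cases j <;> simp, bif j then - n else - n - 1, Or.inr ?_⟩
  have h0 := h.h0
  have hq := h.q0
  have hi := h.hinf
  have hqn := zpow_ne_zero n hq
  cases i <;> cases j <;>
    simp [zpow_sub₀ hq, -mul_eq_mul_right_iff] at he ⊢ <;> field_simp at he ⊢ <;> rw [← he]

theorem midParams_good (h : Admissible q S) {t : ℂ} (ht : GoodTime q S t) :
    (midParams q S t).Good where
  e0 i := by cases i <;> simp [midParams, ht.1, h.h0]
  b0 i := by cases i <;> simp [midParams, h.h1]
  a0 i := by cases i <;> simp [midParams, ht.1, h.ht]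
  k0 i := by cases i <;> simp [midParams, h.hinf, h.q0]
  e_inj i := by
    have := ne_inv_of_sq_ne_one h.h0' h.h0
    cases i <;> simp [midParams, ht.1, this, this.symm]
  b_inj i := by
    have := ne_inv_of_sq_ne_one h.h1' h.h1
    cases i <;> simp [midParams, this, this.symm]
  a_inj i := by
    have := ne_inv_of_sq_ne_one h.ht' h.ht
    cases i <;> simp [midParams, ht.1, this, this.symm]
  k_inj i := by
    have : S.Θinf⁻¹ ≠ S.Θinf / q := by
      have h1 := h.hinf'
      have h2 := h.q0
      have h3 := h.hinf
      intro he
      field_simp at he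
      exact h1 he.symm
    cases i <;> simp [midParams, this, this.symm]
  ab i j := ht.ab h i j
  ek i j he := ht.ek h 0 i j (by rwa [zpow_zero, mul_one])

theorem surfParams_good (h : Admissible q S) {t : ℂ} (ht : GoodTime q S t) :
    (surfParams q S t).Good where
  e0 i := div_ne_zero ((midParams_good h ht).e0 i) h.q0
  b0 := (midParams_good h ht).b0
  a0 := (midParams_good h ht).a0
  k0 := (midParams_good h ht).k0
  e_inj i := fun he => (midParams_good h ht).e_inj i ((div_left_inj' h.q0).1 he)
  b_inj := (midParams_good h ht).b_inj
  a_inj := (midParams_good h ht).a_inj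
  k_inj := (midParams_good h ht).k_inj
  ab i j := ht.ab h i j
  ek i j he := ht.ek h (-1) i j (by rwa [zpow_neg_one, ← div_eq_mul_inv])

variable {F : Type} [Field F] [Algebra ℂ F]

/-- The first half step multiplies the points over `y = 0` by `q` and preserves the other centres up
to labels. -/
theorem dual_surf_mid (h : Admissible q S) (T : F) :
    Params.Dual (algebraMap ℂ F q⁻¹) (surfParams q S T) (midParams q S T) where
  a := rfl
  b := rfl
  e i := by
    have inj := fun u => map_ne_zero_iff (algebraMap ℂ F) (algebraMap ℂ F).injective (x := u)
    have h1 := (inj _).2 h.h0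
    have h2 := (inj _).2 h.h1
    have h3 := (inj _).2 h.ht
    have h4 := (inj _).2 h.q0
    cases i <;> simp [surfParams, midParams] <;> field_simp
  k i := by
    have h1 := h.hinf
    have h2 := h.q0
    cases i <;> simp only [surfParams, midParams, ← map_mul, cond_true, cond_false, Bool.not_true,
      Bool.not_false] <;> congr 1 <;> field_simp

/-- The shift of time arises here: the zeros `T Θ₀^{±1}` of the second `R` are the points over `y =
0` at time `q T`, because `(q T) Θ / q = T Θ`, while the points `(T Θ_t^{±1}, 0)` are moved to `(q T
Θ_t^{±1}, 0)`. -/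
theorem dual_mid_surf (h : Admissible q S) (T : F) :
    Params.Dual 1 (midParams q S T).swap (surfParams q S (algebraMap ℂ F q * T)).swap where
  a := by
    have h4 := (map_ne_zero_iff (algebraMap ℂ F) (algebraMap ℂ F).injective).2 h.q0
    funext i
    simp only [Params.swap, surfParams, midParams]
    rw [mul_assoc, mul_div_cancel_left₀ _ h4]
  b := rfl
  e i := by
    have inj := fun u => map_ne_zero_iff (algebraMap ℂ F) (algebraMap ℂ F).injective (x := u)
    have h1 := (inj _).2 h.h0
    have h2 := (inj _).2 h.hinf
    have h3 := (inj _).2 h.ht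
    have h4 := (inj _).2 h.q0
    cases i <;> simp [surfParams, midParams, Params.swap] <;> field_simp
  k i := by
    have h1 := h.h1
    cases i <;> simp only [Params.swap, surfParams, midParams, ← map_mul, cond_true, cond_false,
      Bool.not_true, Bool.not_false, mul_inv_cancel₀ h1, inv_mul_cancel₀ h1, map_one]

theorem midParams_mem {k : IntermediateField ℂ F} {T : F} (hT : T ∈ k) :
    (midParams q S T).Mem k :=
  ⟨fun _ => mul_mem hT (k.algebraMap_mem _), fun _ => k.algebraMap_mem _,
    fun _ => mul_mem hT (k.algebraMap_mem _), fun _ => k.algebraMap_mem _⟩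

theorem surfParams_mem {k : IntermediateField ℂ F} {T : F} (hT : T ∈ k) :
    (surfParams q S T).Mem k :=
  ⟨fun _ => div_mem (mul_mem hT (k.algebraMap_mem _)) (k.algebraMap_mem _),
    fun _ => k.algebraMap_mem _,
    fun _ => mul_mem hT (k.algebraMap_mem _), fun _ => k.algebraMap_mem _⟩

theorem val_midParams {σ : Type} {s : σ → ℂ} {T : RatFun σ} {t : ℂ} (hT : Val s T t) :
    ValParams s (midParams q S T) (midParams q S t) :=
  ⟨fun _ => hT.mul (Val.const _), fun _ => Val.const _, fun _ => hT.mul (Val.const _),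
    fun _ => Val.const _⟩

theorem val_surfParams (hq : q ≠ 0) {σ : Type} {s : σ → ℂ} {T : RatFun σ} {t : ℂ}
    (hT : Val s T t) : ValParams s (surfParams q S T) (surfParams q S t) :=
  ⟨fun _ => (hT.mul (Val.const _)).div (Val.const _) hq, fun _ => Val.const _,
    fun _ => hT.mul (Val.const _), fun _ => Val.const _⟩

end

/-! ### The full step -/

section

variable (q : ℂ) (S : Spectral) {F : Type} [Field F] [Algebra ℂ F] (T : F)

/-- The first half step, and its inverse. -/
def firstHalf (w : F × F) : F × F :=
  (w.1, Params.rat (algebraMap ℂ F q⁻¹) (midParams q S T) w.1 / w.2)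

/-- The second half step, and its inverse. -/
def secondHalf (w : F × F) : F × F :=
  (Params.rat 1 (midParams q S T).swap w.2 / w.1, w.2)

end

section

variable {q : ℂ} {S : Spectral} {F : Type} [Field F] [Algebra ℂ F] {T : F}
  {k : IntermediateField ℂ F}

theorem Generates.firstHalf (hq : q ≠ 0) (hk : NotSimple k) (hT : T ∈ k) {w : F × F}
    (h : Generates k w.1 w.2) :
    Generates k (firstHalf q S T w).1 (firstHalf q S T w).2 :=
  h.half hk (midParams_mem hT) (k.algebraMap_mem _)
    ((map_ne_zero_iff _ (algebraMap ℂ F).injective).2 (inv_ne_zero hq))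

theorem Generates.secondHalf (hk : NotSimple k) (hT : T ∈ k) {w : F × F}
    (h : Generates k w.1 w.2) :
    Generates k (secondHalf q S T w).1 (secondHalf q S T w).2 :=
  (h.symm.half hk (midParams_mem hT).swap (one_mem k) one_ne_zero).symm

theorem firstHalf_firstHalf (hq : q ≠ 0) (hk : NotSimple k) (hT : T ∈ k) {w : F × F}
    (h : Generates k w.1 w.2) : firstHalf q S T (firstHalf q S T w) = w := by
  refine Prod.ext rfl (div_div_cancel₀ (h.rat_ne_zero hk (midParams_mem hT) ?_))
  exact (map_ne_zero_iff _ (algebraMap ℂ F).injective).2 (inv_ne_zero hq)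

theorem secondHalf_secondHalf (hk : NotSimple k) (hT : T ∈ k) {w : F × F}
    (h : Generates k w.1 w.2) : secondHalf q S T (secondHalf q S T w) = w :=
  Prod.ext (div_div_cancel₀ (h.symm.rat_ne_zero hk (midParams_mem hT).swap one_ne_zero)) rfl

end

section

variable {q : ℂ} {S : Spectral} {t : ℂ} {σ : Type}

/-- `R` depends only on the `a i` and `b i`, which the two configurations share. -/
theorem rat_surfParams (C T y : RatFun σ) :
    Params.rat C (surfParams q S T) y = Params.rat C (midParams q S T) y := rfl

/-- Half step, swap, half step, swap. The order of quantifiers matters: `η` depends on `ξ` only, not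
on the evaluation point or on the pair, so `ξ ↦ η` is a map of surfaces. -/
theorem forward_transport (h : Admissible q S) (ht : GoodTime q S t) (ξ : Surface q S t) :
    ∃ η : Surface q S (q * t), ∀ (s : σ → ℂ) (k : IntermediateField ℂ (RatFun σ)) (T : RatFun σ)
      (w : RatFun σ × RatFun σ), NotSimple k → T ∈ k → Val s T t → Generates k w.1 w.2 →
      PtVal s (surfParams q S T) (surfParams q S t) w.1 w.2 ξ →
      PtVal s (surfParams q S (algebraMap ℂ _ q * T)) (surfParams q S (q * t))
        (secondHalf q S T (firstHalf q S T w)).1 (secondHalf q S T (firstHalf q S T w)).2 η := by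
  have hm := midParams_good h ht
  have hs := surfParams_good h ht
  have hs' := surfParams_good h (ht.mul h)
  obtain ⟨η₁, H₁⟩ := half_transport (σ := σ) hs (inv_ne_zero h.q0) (dual_surf_mid h t)
    (centers_eq_range q S t) rfl ξ
  obtain ⟨η₂, H₂⟩ := swap_transport (σ := σ) hm rfl rfl η₁
  obtain ⟨η₃, H₃⟩ := half_transport (σ := σ) hm.swap one_ne_zero (dual_mid_surf h t) rfl rfl η₂
  obtain ⟨η₄, H₄⟩ := swap_transport (σ := σ) hs'.swap rfl (centers_eq_range q S (q * t)) η₃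
  refine ⟨η₄, fun s k T w hk hTk hT hg hw => ?_⟩
  have hg₁ := hg.firstHalf (S := S) h.q0 hk hTk
  have hg₂ := hg₁.secondHalf (q := q) (S := S) hk hTk
  have hqT := mul_mem (k.algebraMap_mem q) hTk
  have m₁ := midParams_mem (q := q) (S := S) hTk
  have m₂ := surfParams_mem (q := q) (S := S) hqT
  have h₁ := H₁ s _ _ _ _ _ (val_surfParams h.q0 hT) (dual_surf_mid h T) (Val.const _)
    (hg.ne_zero hk) (fun i => hg.ne hk (m₁.a i)) (fun i => hg.ne hk (m₁.b i))
    (hg.symm.ne_zero hk) hw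
  rw [rat_surfParams] at h₁
  have h₂ := H₂ s _ _ _ (hg₁.locCoord_ctr_fst_ne_zero hk m₁)
    (hg₁.locCoord_ctr_snd_ne_zero hk m₁) h₁
  have h₃ := H₃ s _ _ _ _ _ (val_midParams hT).swap (dual_mid_surf h T) Val.one
    (hg₁.symm.ne_zero hk) (fun i => hg₁.symm.ne hk (m₁.e i)) (fun i => hg₁.symm.ne hk (m₁.k i))
    (hg₁.ne_zero hk) h₂
  exact H₄ s (surfParams q S (algebraMap ℂ _ q * T)).swap
    (secondHalf q S T (firstHalf q S T w)).2 (secondHalf q S T (firstHalf q S T w)).1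
    (hg₂.symm.locCoord_ctr_fst_ne_zero hk m₂.swap)
    (hg₂.symm.locCoord_ctr_snd_ne_zero hk m₂.swap) h₃

/-- Each half step is formally its own inverse and duality is symmetric, so the same factors are
used in reverse order. -/
theorem backward_transport (h : Admissible q S) (ht : GoodTime q S t) (ξ : Surface q S (q * t)) :
    ∃ η : Surface q S t, ∀ (s : σ → ℂ) (k : IntermediateField ℂ (RatFun σ)) (T : RatFun σ)
      (w : RatFun σ × RatFun σ), NotSimple k → T ∈ k → Val s T t → Generates k w.1 w.2 →
      PtVal s (surfParams q S (algebraMap ℂ _ q * T)) (surfParams q S (q * t)) w.1 w.2 ξ →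
      PtVal s (surfParams q S T) (surfParams q S t)
        (firstHalf q S T (secondHalf q S T w)).1 (firstHalf q S T (secondHalf q S T w)).2 η := by
  have hm := midParams_good h ht
  have hs' := surfParams_good h (ht.mul h)
  obtain ⟨η₁, H₁⟩ := swap_transport (σ := σ) hs' (centers_eq_range q S (q * t)) rfl ξ
  obtain ⟨η₂, H₂⟩ := half_transport (σ := σ) hs'.swap one_ne_zero (dual_mid_surf h t).symm
    rfl rfl η₁
  obtain ⟨η₃, H₃⟩ := swap_transport (σ := σ) hm.swap rfl rfl η₂
  obtain ⟨η₄, H₄⟩ := half_transport (σ := σ) hm (inv_ne_zero h.q0) (dual_surf_mid h t).symm rfl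
    (centers_eq_range q S t) η₃
  refine ⟨η₄, fun s k T w hk hTk hT hg hw => ?_⟩
  have hg₁ := hg.secondHalf (q := q) (S := S) hk hTk
  have hqT := mul_mem (k.algebraMap_mem q) hTk
  have m₁ := midParams_mem (q := q) (S := S) hTk
  have m₂ := surfParams_mem (q := q) (S := S) hqT
  have hqT' : Val s (algebraMap ℂ _ q * T) (q * t) := (Val.const q).mul hT
  have h₁ := H₁ s _ _ _ (hg.locCoord_ctr_fst_ne_zero hk m₂)
    (hg.locCoord_ctr_snd_ne_zero hk m₂) hw
  have h₂ := H₂ s _ _ _ _ _ (val_surfParams h.q0 hqT').swap (dual_mid_surf h T).symm Val.one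
    (hg.symm.ne_zero hk) (fun i => hg.symm.ne hk (m₂.e i)) (fun i => hg.symm.ne hk (m₂.k i))
    (hg.ne_zero hk) h₁
  have hrat : ∀ y, Params.rat 1 (surfParams q S (algebraMap ℂ (RatFun σ) q * T)).swap y =
      Params.rat 1 (midParams q S T).swap y := fun y => by
    rw [Params.rat, Params.rat, (dual_mid_surf h T).a, (dual_mid_surf h T).b]
  rw [hrat] at h₂
  have h₃ := H₃ s _ _ _ (hg₁.symm.locCoord_ctr_fst_ne_zero hk m₁.swap)
    (hg₁.symm.locCoord_ctr_snd_ne_zero hk m₁.swap) h₂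
  exact H₄ s _ _ _ _ _ (val_midParams hT) (dual_surf_mid h T).symm (Val.const _)
    (hg₁.ne_zero hk) (fun i => hg₁.ne hk (m₁.a i)) (fun i => hg₁.ne hk (m₁.b i))
    (hg₁.symm.ne_zero hk) h₃

end

/-! ### Charts and values -/

section

variable {σ : Type}

/-- The rational function `x` in the affine parametrization `coordAt p`. -/
def ratCoordAt (p : P1) (x : RatFun σ) : RatFun σ := p.elim x⁻¹ (fun c => algebraMap ℂ _ c + x)

/-- The inverse of `ratCoordAt p`. -/
def ratLocCoord (p : P1) (y : RatFun σ) : RatFun σ := p.elim y⁻¹ (fun c => y - algebraMap ℂ _ c)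

@[simp]
theorem ratCoordAt_ratLocCoord (p : P1) (y : RatFun σ) : ratCoordAt p (ratLocCoord p y) = y := by
  rcases P1.cases p with rfl | ⟨c, rfl⟩
  · exact inv_inv y
  · exact add_sub_cancel _ _

@[simp]
theorem ratLocCoord_ratCoordAt (p : P1) (y : RatFun σ) : ratLocCoord p (ratCoordAt p y) = y := by
  rcases P1.cases p with rfl | ⟨c, rfl⟩
  · exact inv_inv y
  · exact add_sub_cancel_left _ _

theorem Val.pval_ratCoordAt {s : σ → ℂ} {x : RatFun σ} {c : ℂ} (h : Val s x c) (hx : x ≠ 0)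
    (p : P1) : PVal s (ratCoordAt p x) (coordAt p c) := by
  rcases P1.cases p with rfl | ⟨d, rfl⟩
  · change PVal s x⁻¹ (ratio 1 c)
    have := PVal.inv (p := (c : P1)) hx h
    rwa [divBy_coe] at this
  · exact (Val.const d).add h

theorem PVal.val_ratLocCoord {s : σ → ℂ} {y : RatFun σ} {p : P1} (h : PVal s y p) :
    Val s (ratLocCoord p y) 0 := by
  rcases P1.cases p with rfl | ⟨d, rfl⟩
  · exact h.2
  · have := Val.sub h (Val.const d)
    rwa [sub_self] at this

@[simp]
theorem coordAt_zero (p : P1) : coordAt p 0 = p := by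
  rcases P1.cases p with rfl | ⟨d, rfl⟩
  · simp [coordAt, ratio, infPt]
  · simp [coordAt]

/-- The pair of rational functions `(y, z)`, viewed as a map to the blow-up, is regular at `s` with
the given value. -/
def BlowUpVal (s : σ → ℂ) (w : RatFun σ × RatFun σ) {Γ : Set (P1 × P1)} : BlowUp Γ → Prop
  | .base p _ => PVal s w.1 p.1 ∧ PVal s w.2 p.2
  | .exc γ _ m => PVal s w.1 γ.1 ∧ PVal s w.2 γ.2 ∧
      PVal s (ratLocCoord γ.2 w.2 / ratLocCoord γ.1 w.1) m

variable {Γ : Set (P1 × P1)} {s : σ → ℂ} {w : RatFun σ × RatFun σ}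

theorem BlowUpVal.down {ξ : BlowUp Γ} (h : BlowUpVal s w ξ) :
    PVal s w.1 ξ.down.1 ∧ PVal s w.2 ξ.down.2 := by
  cases ξ with
  | base p hp => exact h
  | exc γ hγ m => exact ⟨h.1, h.2.1⟩

theorem BlowUpVal.unique {ξ η : BlowUp Γ} (h : BlowUpVal s w ξ) (h' : BlowUpVal s w η) :
    ξ = η := by
  have hd : ξ.down = η.down :=
    Prod.ext (h.down.1.unique h'.down.1) (h.down.2.unique h'.down.2)
  cases ξ with
  | base p hp =>
    cases η with
    | base p' hp' =>
      obtain rfl : p = p' := hd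
      rfl
    | exc γ hγ m =>
      obtain rfl : p = γ := hd
      exact absurd hγ hp
  | exc γ hγ m =>
    cases η with
    | base p' hp' =>
      obtain rfl : γ = p' := hd
      exact absurd hγ hp'
    | exc γ' hγ' m' =>
      obtain rfl : γ = γ' := hd
      obtain rfl := h.2.2.unique h'.2.2
      rfl

/-- The pair of rational functions with coordinates `u`, `v` in the given chart. -/
def Chart.pair (k : Chart Γ) (u v : RatFun σ) : RatFun σ × RatFun σ :=
  match k with
  | .plain p _ => (ratCoordAt p.1 u, ratCoordAt p.2 v)
  | .first γ _ => (ratCoordAt γ.1 u, ratCoordAt γ.2 (u * v))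
  | .second γ _ => (ratCoordAt γ.1 (u * v), ratCoordAt γ.2 v)

theorem Chart.pval_pair (k : Chart Γ) {u v : RatFun σ} {a : Fin 2 → ℂ} (hu : u ≠ 0) (hv : v ≠ 0)
    (hu' : Val s u (a 0)) (hv' : Val s v (a 1)) :
    PVal s (k.pair u v).1 (k.down a).1 ∧ PVal s (k.pair u v).2 (k.down a).2 := by
  cases k with
  | plain p hp => exact ⟨hu'.pval_ratCoordAt hu _, hv'.pval_ratCoordAt hv _⟩
  | first γ hγ =>
    exact ⟨hu'.pval_ratCoordAt hu _, (hu'.mul hv').pval_ratCoordAt (mul_ne_zero hu hv) _⟩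
  | second γ hγ =>
    exact ⟨(hu'.mul hv').pval_ratCoordAt (mul_ne_zero hu hv) _, hv'.pval_ratCoordAt hv _⟩

theorem Chart.Rep.blowUpVal {k : Chart Γ} {u v : RatFun σ} {a : Fin 2 → ℂ} (hu : u ≠ 0)
    (hv : v ≠ 0) (hu' : Val s u (a 0)) (hv' : Val s v (a 1)) {ξ : BlowUp Γ} (h : k.Rep a ξ) :
    BlowUpVal s (k.pair u v) ξ := by
  cases ξ with
  | base p hp =>
    obtain rfl : k.down a = p := h
    exact k.pval_pair hu hv hu' hv'
  | exc γ hγ m =>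
    cases k with
    | plain p hp => exact h.elim
    | first γ' hγ' =>
      obtain ⟨rfl, h0, rfl⟩ := h
      have h1 := (Chart.first γ' hγ').pval_pair hu hv hu' hv'
      simp only [Chart.down, h0, zero_mul, coordAt_zero] at h1
      refine ⟨h1.1, h1.2, ?_⟩
      simp only [Chart.pair, ratLocCoord_ratCoordAt]
      rw [mul_div_cancel_left₀ _ hu]
      exact hv'
    | second γ' hγ' =>
      obtain ⟨rfl, h0, rfl⟩ := h
      have h1 := (Chart.second γ' hγ').pval_pair hu hv hu' hv'
      simp only [Chart.down, h0, mul_zero, coordAt_zero] at h1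
      refine ⟨h1.1, h1.2, ?_⟩
      simp only [Chart.pair, ratLocCoord_ratCoordAt]
      rw [div_mul_cancel_right₀ hv]
      exact hu'.pval_ratCoordAt hu infPt

theorem exists_rep (ξ : BlowUp Γ) : ∃ (k : Chart Γ) (a : Fin 2 → ℂ), k.Rep a ξ := by
  cases ξ with
  | base p hp => exact ⟨.plain p hp, 0, by simp [Chart.Rep, Chart.down]⟩
  | exc γ hγ m =>
    rcases P1.cases m with rfl | ⟨c, rfl⟩
    · exact ⟨.second γ hγ, ![0, 0], rfl, rfl, by simp [ratio]⟩
    · exact ⟨.first γ hγ, ![0, c], rfl, rfl, rfl⟩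

/-- One nonvanishing condition excludes each centre other than `p`; as there are finitely many, the
product of these polynomials works. -/
theorem exists_open_avoiding (hΓ : Γ.Finite) {p : P1 × P1} (h1 : PVal s w.1 p.1)
    (h2 : PVal s w.2 p.2) :
    ∃ H : MvPolynomial σ ℂ, MvPolynomial.eval s H ≠ 0 ∧ ∀ b, MvPolynomial.eval b H ≠ 0 →
      ∀ γ ∈ Γ, PVal b w.1 γ.1 → PVal b w.2 γ.2 → γ = p := by
  induction Γ, hΓ using Set.Finite.induction_on with
  | empty => exact ⟨1, by simp, by simp⟩
  | @insert γ Γ _ _ ih =>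
    obtain ⟨H, hH, ih⟩ := ih
    by_cases h : γ = p
    · refine ⟨H, hH, fun b hb γ' hγ' h1' h2' => ?_⟩
      rcases hγ' with rfl | hγ'
      · exact h
      · exact ih b hb _ hγ' h1' h2'
    · have : ∃ H' : MvPolynomial σ ℂ, MvPolynomial.eval s H' ≠ 0 ∧
          ∀ b, MvPolynomial.eval b H' ≠ 0 → PVal b w.1 γ.1 → PVal b w.2 γ.2 → False := by
        by_cases h' : γ.1 = p.1
        · obtain ⟨H', hH', h''⟩ := h2.exists_open_ne (fun h'' => h (Prod.ext h' h''))
          exact ⟨H', hH', fun b hb _ => h'' b hb⟩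
        · obtain ⟨H', hH', h''⟩ := h1.exists_open_ne h'
          exact ⟨H', hH', fun b hb h _ => h'' b hb h⟩
      obtain ⟨H', hH', h''⟩ := this
      refine ⟨H * H', by simp [hH, hH'], fun b hb γ' hγ' h1' h2' => ?_⟩
      rw [map_mul, mul_ne_zero_iff] at hb
      rcases hγ' with rfl | hγ'
      · exact (h'' b hb.2 h1' h2').elim
      · exact ih b hb.1 _ hγ' h1' h2'

/-- Around every point, the coordinates of a pair of rational functions in a suitable chart around
its value are regular, and represent the values of the pair at all nearby points. -/
theorem BlowUpVal.exists_chart (hΓ : Γ.Finite) (h1 : ∀ p, ratLocCoord p w.1 ≠ 0)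
    (h2 : ∀ p, ratLocCoord p w.2 ≠ 0) {η : BlowUp Γ} (h : BlowUpVal s w η) :
    ∃ (k : Chart Γ) (φ ψ : RatFun σ) (u v : ℂ) (H : MvPolynomial σ ℂ), Val s φ u ∧ Val s ψ v ∧
      MvPolynomial.eval s H ≠ 0 ∧
      ∀ (b : σ → ℂ) (u' v' : ℂ) (ξ : BlowUp Γ), Val b φ u' → Val b ψ v' →
        MvPolynomial.eval b H ≠ 0 → BlowUpVal b w ξ → k.Rep ![u', v'] ξ := by
  obtain ⟨H, hH, hav⟩ := exists_open_avoiding hΓ h.down.1 h.down.2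
  -- A point outside the centres is determined by its image downstairs, so there it suffices that
  -- the chart coordinates recover `w`.
  have key : ∀ (k : Chart Γ) (φ ψ : RatFun σ), φ ≠ 0 → ψ ≠ 0 → k.pair φ ψ = w →
      ∀ (b : σ → ℂ) (u' v' : ℂ) (p : P1 × P1) (hp : p ∉ Γ), Val b φ u' → Val b ψ v' →
        BlowUpVal b w (BlowUp.base p hp) → k.Rep ![u', v'] (BlowUp.base p hp) := by
    intro k φ ψ hφ hψ hk b u' v' p hp hu hv h
    have h3 := k.pval_pair (a := ![u', v']) hφ hψ hu hv
    rw [hk] at h3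
    exact Prod.ext (h3.1.unique h.1) (h3.2.unique h.2)
  cases η with
  | base p hp =>
    refine ⟨.plain p hp, ratLocCoord p.1 w.1, ratLocCoord p.2 w.2, 0, 0, H, h.1.val_ratLocCoord,
      h.2.val_ratLocCoord, hH, fun b u' v' ξ hu hv hb hξ => ?_⟩
    cases ξ with
    | base p' hp' => exact key _ _ _ (h1 _) (h2 _) (by simp [Chart.pair]) b _ _ _ _ hu hv hξ
    | exc γ hγ m =>
      obtain rfl : γ = p := hav b hb γ hγ hξ.1 hξ.2.1
      exact absurd hγ hp
  | exc γ hγ m =>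
    have h10 := h1 γ.1
    have h20 := h2 γ.2
    obtain ⟨hw1, hw2, hm⟩ := h
    rcases P1.cases m with rfl | ⟨c, rfl⟩
    -- At slope `∞` the inverse slope is regular with value `0`, so the second chart applies; at
    -- finite slope the first does.
    · refine ⟨.second γ hγ, ratLocCoord γ.1 w.1 / ratLocCoord γ.2 w.2, ratLocCoord γ.2 w.2, 0, 0,
        H, ?_, hw2.val_ratLocCoord, hH, fun b u' v' ξ hu hv hb hξ => ?_⟩
      · rw [← inv_div]
        exact hm.2
      cases ξ with
      | base p' hp' =>
        refine key _ _ _ (div_ne_zero h10 h20) h20 ?_ b _ _ _ _ hu hv hξ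
        simp [Chart.pair, div_mul_cancel₀ _ h20]
      | exc γ' hγ' m' =>
        obtain rfl : γ' = γ := hav b hb γ' hγ' hξ.1 hξ.2.1
        refine ⟨rfl, hv.unique hξ.2.1.val_ratLocCoord, hξ.2.2.unique ?_⟩
        have := hu.pval_ratCoordAt (div_ne_zero h10 h20) infPt
        change PVal b _⁻¹ (ratio 1 u') at this
        rwa [inv_div] at this
    · refine ⟨.first γ hγ, ratLocCoord γ.1 w.1, ratLocCoord γ.2 w.2 / ratLocCoord γ.1 w.1, 0, c,
        H, hw1.val_ratLocCoord, hm, hH, fun b u' v' ξ hu hv hb hξ => ?_⟩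
      cases ξ with
      | base p' hp' =>
        refine key _ _ _ h10 (div_ne_zero h20 h10) ?_ b _ _ _ _ hu hv hξ
        simp [Chart.pair, mul_div_cancel₀ _ h10]
      | exc γ' hγ' m' =>
        obtain rfl : γ' = γ := hav b hb γ' hγ' hξ.1 hξ.2.1
        exact ⟨rfl, hu.unique hξ.1.val_ratLocCoord, hξ.2.2.unique hv⟩

end

/-! ### Regularity of maps induced on blow-ups. -/

section

variable {Γ Γ' : Set (P1 × P1)}

theorem IsRegular.isHolomorphic {F : BlowUp Γ → BlowUp Γ'} (h : IsRegular F) :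
    IsHolomorphic F := by
  intro x
  obtain ⟨k, k', a, A, B, C, D, hx, hB, hD, H⟩ := h x
  have hdiff : ∀ P : MvPolynomial (Fin 2) ℂ, Differentiable ℂ fun b => MvPolynomial.eval b P := by
    intro P
    induction P using MvPolynomial.induction_on with
    | C c => simp
    | add p q hp hq => simp only [map_add]; exact hp.add hq
    | mul_X p i hp =>
      simp only [map_mul, MvPolynomial.eval_X]
      exact hp.mul (differentiable_apply i)
  have hdiv : ∀ (P Q : MvPolynomial (Fin 2) ℂ) (U : Set (Fin 2 → ℂ)),
      (∀ b ∈ U, MvPolynomial.eval b Q ≠ 0) →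
      DifferentiableOn ℂ (fun b => MvPolynomial.eval b P / MvPolynomial.eval b Q) U := by
    intro P Q U hU
    simp only [div_eq_mul_inv]
    exact (hdiff P).differentiableOn.mul ((hdiff Q).differentiableOn.inv hU)
  refine ⟨k, k', a, {b | MvPolynomial.eval b B ≠ 0} ∩ {b | MvPolynomial.eval b D ≠ 0},
    fun b => ![MvPolynomial.eval b A / MvPolynomial.eval b B,
        MvPolynomial.eval b C / MvPolynomial.eval b D], hx, ?_, ⟨hB, hD⟩, ?_,
    fun b x' hx' hb => H b x' hx' hb.1 hb.2⟩
  · exact ((hdiff B).continuous.isOpen_preimage _ isOpen_compl_singleton).inter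
      ((hdiff D).continuous.isOpen_preimage _ isOpen_compl_singleton)
  · rw [differentiableOn_pi]
    intro i
    fin_cases i
    · exact hdiv A B _ fun b hb => hb.1
    · exact hdiv C D _ fun b hb => hb.2

theorem ratLocCoord_ne_zero {y z : RatFun (Fin 2)} (h : Generates ⊥ y z) (p : P1) :
    ratLocCoord p y ≠ 0 := by
  rcases P1.cases p with rfl | ⟨c, rfl⟩
  · exact inv_ne_zero (h.ne_zero notSimple_bot)
  · exact sub_ne_zero.2 (h.ne notSimple_bot (IntermediateField.algebraMap_mem _ c))

theorem ratCoordAt_mem_iff {L : IntermediateField ℂ (RatFun (Fin 2))} {p : P1}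
    {x : RatFun (Fin 2)} : ratCoordAt p x ∈ L ↔ x ∈ L := by
  rcases P1.cases p with rfl | ⟨c, rfl⟩
  · exact inv_mem_iff
  · exact ⟨fun h => by simpa [ratCoordAt] using sub_mem h (L.algebraMap_mem c),
      fun h => add_mem (L.algebraMap_mem c) h⟩

theorem ofPoly_X_ne_zero {σ : Type} (i : σ) : ofPoly (MvPolynomial.X i : MvPolynomial σ ℂ) ≠ 0 :=
  ofPoly_ne_zero.2 (MvPolynomial.X_ne_zero i)

/-- The pair of coordinate functions of a chart. -/
def Chart.genericPair (k : Chart Γ) : RatFun (Fin 2) × RatFun (Fin 2) :=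
  k.pair (ofPoly (MvPolynomial.X 0)) (ofPoly (MvPolynomial.X 1))

theorem Chart.Rep.genericPair {k : Chart Γ} {a : Fin 2 → ℂ} {ξ : BlowUp Γ} (h : k.Rep a ξ) :
    BlowUpVal a k.genericPair ξ := by
  refine h.blowUpVal (ofPoly_X_ne_zero 0) (ofPoly_X_ne_zero 1) ?_ ?_
  · simpa using Val.ofPoly (a := a) (MvPolynomial.X 0)
  · simpa using Val.ofPoly (a := a) (MvPolynomial.X 1)

theorem Chart.generates (k : Chart Γ) : Generates ⊥ k.genericPair.1 k.genericPair.2 := by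
  intro L _ h1 h2
  have h0 := ofPoly_X_ne_zero (0 : Fin 2)
  have h0' := ofPoly_X_ne_zero (1 : Fin 2)
  suffices h : ofPoly (MvPolynomial.X 0) ∈ L ∧ ofPoly (MvPolynomial.X 1) ∈ L by
    refine eq_top_of_X_mem fun i => ?_
    fin_cases i
    exacts [h.1, h.2]
  cases k with
  | plain p hp => exact ⟨ratCoordAt_mem_iff.1 h1, ratCoordAt_mem_iff.1 h2⟩
  | first γ hγ =>
    have h3 := ratCoordAt_mem_iff.1 h1
    have h4 := div_mem (ratCoordAt_mem_iff.1 h2) h3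
    rw [mul_div_cancel_left₀ _ h0] at h4
    exact ⟨h3, h4⟩
  | second γ hγ =>
    have h3 := ratCoordAt_mem_iff.1 h2
    have h4 := div_mem (ratCoordAt_mem_iff.1 h1) h3
    rw [mul_div_cancel_right₀ _ h0'] at h4
    exact ⟨h4, h3⟩

/-- A map of blow-ups induced by a map of generic pairs of rational functions is regular. -/
theorem isRegular_of_transport (hΓ' : Γ'.Finite) {F : BlowUp Γ → BlowUp Γ'}
    {step : RatFun (Fin 2) × RatFun (Fin 2) → RatFun (Fin 2) × RatFun (Fin 2)}
    (hstep : ∀ w, Generates ⊥ w.1 w.2 → Generates ⊥ (step w).1 (step w).2)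
    (hF : ∀ ξ s w, Generates ⊥ w.1 w.2 → BlowUpVal s w ξ → BlowUpVal s (step w) (F ξ)) :
    IsRegular F := by
  intro x
  obtain ⟨k, a, hx⟩ := exists_rep x
  have hg := k.generates
  have hg' := hstep _ hg
  obtain ⟨k', φ, ψ, u, v, H, ⟨A, B, hB, hφ, -⟩, ⟨C, D, hD, hψ, -⟩, hH, key⟩ :=
    (hF x a _ hg hx.genericPair).exists_chart hΓ' (ratLocCoord_ne_zero hg')
      (ratLocCoord_ne_zero hg'.symm)
  -- `IsRegular` restricts the domain only through its denominators, so the condition `H ≠ 0` is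
  -- imposed by expanding the first fraction by `H`.
  refine ⟨k, k', a, A * H, B * H, C, D, hx, by simp [hB, hH], hD, fun b x' hx' hb hd => ?_⟩
  rw [map_mul, mul_ne_zero_iff] at hb
  rw [map_mul, map_mul, mul_div_mul_right _ _ hb.2]
  exact key b _ _ _ ⟨A, B, hb.1, hφ, rfl⟩ ⟨C, D, hd, hψ, rfl⟩ hb.2
    (hF x' b _ hg hx'.genericPair)

end

section

variable {q : ℂ} {S : Spectral}

/-! ### Comparison with the rational map on `ℙ¹ × ℙ¹` -/

/-- Of the nine ways in which a factor of each form can vanish, four give centres. Four others would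
equate some `t Θ_t^{±1}` with some `Θ₁^{±1}`, and the last would equate `0` with `∞`. -/
theorem gNum_ne_zero_or (h : Admissible q S) {t : ℂ} (ht : GoodTime q S t) {p : P1 × P1}
    (hp : p ∉ centers q S t) : gNum S t p ≠ 0 ∨ gDen q S p ≠ 0 := by
  by_contra! hc
  obtain ⟨h1, h2⟩ := hc
  simp only [gNum, gDen, mul_eq_zero, num_sub_mul_den_eq_zero_iff, den_eq_zero_iff,
    num_eq_zero_iff, h.q0, false_or] at h1 h2
  have hab : ∀ i j, ¬ ((t * (bif i then S.Θt else S.Θt⁻¹) : ℂ) : P1) =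
      ((bif j then S.Θ1 else S.Θ1⁻¹ : ℂ) : P1) := fun i j he =>
    ht.ab h i j (OnePoint.coe_eq_coe.1 he)
  apply hp
  rw [centers_eq_range]
  rcases h1 with (h1 | h1) | h1 <;> rcases h2 with (h2 | h2) | h2
  · exact ⟨.a true, (Prod.ext h1 h2).symm⟩
  · exact absurd (h1.symm.trans h2) (hab true true)
  · exact absurd (h1.symm.trans h2) (hab true false)
  · exact ⟨.a false, (Prod.ext h1 h2).symm⟩
  · exact absurd (h1.symm.trans h2) (hab false true)
  · exact absurd (h1.symm.trans h2) (hab false false)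
  · exact absurd (h1.symm.trans h2) (infPt_ne_coe 0)
  · exact ⟨.b true, (Prod.ext h2 h1).symm⟩
  · exact ⟨.b false, (Prod.ext h2 h1).symm⟩

theorem eq_coe_of_den_eq {p : P1} {c d : ℂ} (hd : d ≠ 0) (h : c * den p = d * num p) :
    p = ((c / d : ℂ) : P1) := by
  rcases P1.cases p with rfl | ⟨x, rfl⟩
  · simp [eq_comm, hd] at h
  · simp only [den_coe, num_coe, mul_one] at h
    rw [h, mul_div_cancel_left₀ _ hd]

/-- On `y = ∞` and `y = 0` one has `g = 1 / (q z)` and `g = t² / (q z)`, so a common zero there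
forces `z` to be the coordinate of a centre. Elsewhere `g` would have to equal both some `t Θ₀^{±1}`
and one of `Θ_∞⁻¹`, `Θ_∞ / q`, which a good time excludes. -/
theorem fNum_ne_zero_or (h : Admissible q S) {t : ℂ} (ht : GoodTime q S t) {p : P1 × P1}
    (hp : p ∉ centers q S t) : fNum q S t p ≠ 0 ∨ fDen q S t p ≠ 0 := by
  have hg := gNum_ne_zero_or h ht hp
  have hne : ∀ i j, gNum S t p = t * (bif i then S.Θ0 else S.Θ0⁻¹) * gDen q S p →
      gNum S t p = (bif j then S.Θinf⁻¹ else S.Θinf / q) * gDen q S p → False := by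
    intro i j h1 h2
    have h3 := ht.ek h 0 i j
    rw [zpow_zero, mul_one] at h3
    rw [h1] at h2
    by_cases hD : gDen q S p = 0
    · rw [hD, mul_zero] at h1
      exact hg.elim (· h1) (· hD)
    · exact h3 (mul_right_cancel₀ hD h2)
  have hinf : ∀ c, c ≠ 0 → p.1 = infPt → gNum S t p = c * gDen q S p →
      p.2 = ((1 / (c * q) : ℂ) : P1) := by
    intro c hc h1 h2
    apply eq_coe_of_den_eq (mul_ne_zero hc h.q0)
    simp only [gNum, gDen, h1, num_infPt, den_infPt, mul_zero, sub_zero, mul_one] at h2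
    rw [h2]
    ring
  have hzero : ∀ c, c ≠ 0 → p.1 = ((0 : ℂ) : P1) → gNum S t p = t * c * gDen q S p →
      p.2 = ((t / (c * q) : ℂ) : P1) := by
    intro c hc h1 h2
    apply eq_coe_of_den_eq (mul_ne_zero hc h.q0)
    simp only [gNum, gDen, h1, num_coe, den_coe, mul_one, zero_sub] at h2
    have h3 := h.ht
    have h4 := h.h1
    have h5 := ht.1
    field_simp at h2
    exact h2
  have hq := h.q0
  have hi := h.hinf
  have h0 := h.h0
  by_contra! hc
  obtain ⟨h1, h2⟩ := hc
  simp only [fNum, fDen, mul_eq_zero, sub_eq_zero, den_eq_zero_iff, num_eq_zero_iff] at h1 h2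
  have key : p ∈ Set.range (surfParams q S t).ctr := by
    rcases h1 with (h1 | h1) | h1 <;> rcases h2 with (h2 | h2) | h2
    · exact absurd (h1.symm.trans h2) (infPt_ne_coe 0)
    · refine ⟨.k true, Prod.ext h1.symm ?_⟩
      rw [hinf _ (div_ne_zero hi hq) h1 h2, div_mul_cancel₀ _ hq, one_div]
      rfl
    · refine ⟨.k false, Prod.ext h1.symm ?_⟩
      rw [hinf _ (inv_ne_zero hi) h1 h2, one_div, mul_inv, inv_inv, ← div_eq_mul_inv]
      rfl
    · refine ⟨.e false, Prod.ext h2.symm ?_⟩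
      rw [hzero _ h0 h2 h1, ← div_div, div_eq_mul_inv t]
      rfl
    · exact (hne true false h1 h2).elim
    · exact (hne true true h1 h2).elim
    · refine ⟨.e true, Prod.ext h2.symm ?_⟩
      rw [hzero _ (inv_ne_zero h0) h2 h1, ← div_div, div_inv_eq_mul]
      rfl
    · exact (hne false false h1 h2).elim
    · exact (hne false true h1 h2).elim
  exact hp (centers_eq_range q S t ▸ key)

variable {σ : Type}

/-- In regular homogeneous coordinates the step is a pair of quotients whose numerators and
denominators take the values `fNum`, `fDen`, `gNum`, `gDen`; off the centres neither pair of values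
vanishes. -/
theorem pval_painleveMap (h : Admissible q S) {t : ℂ} (ht : GoodTime q S t) {s : σ → ℂ}
    {k : IntermediateField ℂ (RatFun σ)} (hk : NotSimple k) {w : RatFun σ × RatFun σ}
    (hw : Generates k w.1 w.2) {p : P1 × P1} (hp : p ∉ centers q S t) (h1 : PVal s w.1 p.1)
    (h2 : PVal s w.2 p.2) :
    PVal s (secondHalf q S (algebraMap ℂ _ t) (firstHalf q S (algebraMap ℂ _ t) w)).1
        (painleveMap q S t p).1 ∧
      PVal s (secondHalf q S (algebraMap ℂ _ t) (firstHalf q S (algebraMap ℂ _ t) w)).2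
        (painleveMap q S t p).2 := by
  obtain ⟨N₁, M₁, hN₁, hM₁, hM₁0, e₁⟩ := h1.exists_homogeneous
  obtain ⟨N₂, M₂, hN₂, hM₂, hM₂0, e₂⟩ := h2.exists_homogeneous
  have hT : algebraMap ℂ (RatFun σ) t ∈ k := k.algebraMap_mem t
  have hg := hw.firstHalf (S := S) h.q0 hk hT
  have hN₁0 : N₁ ≠ 0 := fun h => hw.ne_zero hk (by rw [e₁, h, zero_div])
  have hN₂0 : N₂ ≠ 0 := fun h => hw.symm.ne_zero hk (by rw [e₂, h, zero_div])
  have hsub : ∀ c : ℂ, N₁ - algebraMap ℂ _ c * M₁ ≠ 0 := fun c hc =>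
    hw.ne hk (k.algebraMap_mem c) (by rw [e₁, div_eq_iff hM₁0, sub_eq_zero.1 hc])
  have hq' : algebraMap ℂ (RatFun σ) q ≠ 0 := (Val.const (a := s) q).ne_zero h.q0
  let G := (N₁ - algebraMap ℂ _ (t * S.Θt) * M₁) * (N₁ - algebraMap ℂ _ (t * S.Θt⁻¹) * M₁) * M₂
  let H := algebraMap ℂ _ q * N₂ * (N₁ - algebraMap ℂ _ S.Θ1 * M₁) *
    (N₁ - algebraMap ℂ _ S.Θ1⁻¹ * M₁)
  have hG : Val s G (gNum S t p) :=
    ((hN₁.sub ((Val.const _).mul hM₁)).mul (hN₁.sub ((Val.const _).mul hM₁))).mul hM₂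
  have hH : Val s H (gDen q S p) :=
    (((Val.const q).mul hN₂).mul (hN₁.sub ((Val.const _).mul hM₁))).mul
      (hN₁.sub ((Val.const _).mul hM₁))
  have hH0 : H ≠ 0 := mul_ne_zero (mul_ne_zero (mul_ne_zero hq' hN₂0) (hsub _)) (hsub _)
  have e₃ : (firstHalf q S (algebraMap ℂ _ t) w).2 = G / H := by
    have a1 := hsub S.Θ1
    have a2 := hsub S.Θ1⁻¹
    have a3 : ∀ c, N₁ / M₁ - c = (N₁ - c * M₁) / M₁ := fun c => by field_simp
    simp only [firstHalf, Params.rat, midParams, cond_true, cond_false, e₁, e₂, a3, ← map_mul]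
    rw [map_inv₀]
    simp only [G, H]
    generalize N₁ - algebraMap ℂ _ S.Θ1 * M₁ = u at *
    generalize N₁ - algebraMap ℂ _ S.Θ1⁻¹ * M₁ = v at *
    field_simp
  have hsub' : ∀ c : ℂ, G - algebraMap ℂ _ c * H ≠ 0 := fun c hc =>
    hg.symm.ne hk (k.algebraMap_mem c) (by rw [e₃, div_eq_iff hH0, sub_eq_zero.1 hc])
  let A := M₁ * (G - algebraMap ℂ _ (t * S.Θ0) * H) * (G - algebraMap ℂ _ (t * S.Θ0⁻¹) * H)
  let B := N₁ * (G - algebraMap ℂ _ (S.Θinf / q) * H) * (G - algebraMap ℂ _ S.Θinf⁻¹ * H)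
  have hA : Val s A (fNum q S t p) :=
    (hM₁.mul (hG.sub ((Val.const _).mul hH))).mul (hG.sub ((Val.const _).mul hH))
  have hB : Val s B (fDen q S t p) :=
    (hN₁.mul (hG.sub ((Val.const _).mul hH))).mul (hG.sub ((Val.const _).mul hH))
  have hB0 : B ≠ 0 := mul_ne_zero (mul_ne_zero hN₁0 (hsub' _)) (hsub' _)
  have e₄ : (secondHalf q S (algebraMap ℂ _ t) (firstHalf q S (algebraMap ℂ _ t) w)).1 =
      A / B := by
    have a1 := hsub' (S.Θinf / q)
    have a2 := hsub' S.Θinf⁻¹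
    have a3 : ∀ c, G / H - c = (G - c * H) / H := fun c => by field_simp
    rw [secondHalf, e₃, firstHalf]
    simp only [Params.rat, Params.swap, midParams, cond_true, cond_false, e₁, a3, ← map_mul]
    simp only [A, B]
    generalize G - algebraMap ℂ _ (S.Θinf / q) * H = u at *
    generalize G - algebraMap ℂ _ S.Θinf⁻¹ * H = v at *
    generalize G = G at *
    generalize H = H at *
    field_simp
  refine ⟨?_, ?_⟩
  · rw [e₄]
    exact pval_ratio hA hB hB0 (fNum_ne_zero_or h ht hp)
  · change PVal s (firstHalf q S (algebraMap ℂ _ t) w).2 _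
    rw [e₃]
    exact pval_ratio hG hH hH0 (gNum_ne_zero_or h ht hp)

/-! ### The isomorphism of surfaces -/

theorem locCoord_surfParams_fst (t : ℂ) (i : CtrIdx) (y : RatFun σ) :
    locCoord ((surfParams q S (algebraMap ℂ (RatFun σ) t)).ctr i).1 y =
      ratLocCoord ((surfParams q S t).ctr i).1 y := by
  rcases i with i | i | i | i <;> simp [Params.ctr, surfParams, ratLocCoord]

theorem locCoord_surfParams_snd (t : ℂ) (i : CtrIdx) (y : RatFun σ) :
    locCoord ((surfParams q S (algebraMap ℂ (RatFun σ) t)).ctr i).2 y =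
      ratLocCoord ((surfParams q S t).ctr i).2 y := by
  rcases i with i | i | i | i <;> simp [Params.ctr, surfParams, ratLocCoord]

/-- At a constant time the moving centres are constants, and the two notions of slope agree. -/
theorem ptVal_iff_blowUpVal {t : ℂ} {s : σ → ℂ} {w : RatFun σ × RatFun σ} {ξ : Surface q S t} :
    PtVal s (surfParams q S (algebraMap ℂ _ t)) (surfParams q S t) w.1 w.2 ξ ↔
      BlowUpVal s w ξ := by
  cases ξ with
  | base p hp => rfl
  | exc γ hγ m =>
    have hmem : γ ∈ Set.range (surfParams q S t).ctr := centers_eq_range q S t ▸ hγ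
    simp only [PtVal, BlowUpVal, locCoord_surfParams_fst, locCoord_surfParams_snd]
    constructor
    · rintro ⟨h1, h2, i, rfl, h3⟩
      exact ⟨h1, h2, h3⟩
    · rintro ⟨h1, h2, h3⟩
      obtain ⟨i, rfl⟩ := hmem
      exact ⟨h1, h2, i, rfl, h3⟩

theorem centers_finite (t : ℂ) : (centers q S t).Finite := by
  simp [centers]

/-- Every point is the value of the generic pair of some chart. The forward and backward steps are
mutually inverse on generic pairs, so uniqueness of values makes the pointwise chosen maps mutually
inverse. The comparison with `painleveMap` is again uniqueness of values. -/
theorem exists_surface_equiv (h : Admissible q S) {t : ℂ} (ht : GoodTime q S t) :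
    ∃ F : Surface q S t ≃ Surface q S (q * t),
      (∀ x : Surface q S t, x.down ∉ centers q S t → (F x).down = painleveMap q S t x.down) ∧
      IsRegular F ∧ IsRegular F.symm := by
  choose f hf using forward_transport (σ := Fin 2) h ht
  choose g hg using backward_transport (σ := Fin 2) h ht
  have hbot : ∀ c : ℂ, algebraMap ℂ (RatFun (Fin 2)) c ∈ (⊥ : IntermediateField ℂ _) :=
    fun c => IntermediateField.algebraMap_mem _ c
  let fwd : RatFun (Fin 2) × RatFun (Fin 2) → RatFun (Fin 2) × RatFun (Fin 2) := fun w =>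
    secondHalf q S (algebraMap ℂ _ t) (firstHalf q S (algebraMap ℂ _ t) w)
  let bwd : RatFun (Fin 2) × RatFun (Fin 2) → RatFun (Fin 2) × RatFun (Fin 2) := fun w =>
    firstHalf q S (algebraMap ℂ _ t) (secondHalf q S (algebraMap ℂ _ t) w)
  have gf : ∀ w, Generates ⊥ w.1 w.2 → Generates ⊥ (fwd w).1 (fwd w).2 := fun w hw =>
    (hw.firstHalf h.q0 notSimple_bot (hbot t)).secondHalf notSimple_bot (hbot t)
  have gb : ∀ w, Generates ⊥ w.1 w.2 → Generates ⊥ (bwd w).1 (bwd w).2 := fun w hw =>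
    (hw.secondHalf notSimple_bot (hbot t)).firstHalf h.q0 notSimple_bot (hbot t)
  have hf' : ∀ ξ s w, Generates ⊥ w.1 w.2 → BlowUpVal s w ξ → BlowUpVal s (fwd w) (f ξ) := by
    intro ξ s w hw hξ
    have := hf ξ s ⊥ _ w notSimple_bot (hbot t) (Val.const t) hw (ptVal_iff_blowUpVal.2 hξ)
    rw [← map_mul] at this
    exact ptVal_iff_blowUpVal.1 this
  have hg' : ∀ ξ s w, Generates ⊥ w.1 w.2 → BlowUpVal s w ξ → BlowUpVal s (bwd w) (g ξ) := by
    intro ξ s w hw hξ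
    refine ptVal_iff_blowUpVal.1
      (hg ξ s ⊥ _ w notSimple_bot (hbot t) (Val.const t) hw ?_)
    rw [← map_mul]
    exact ptVal_iff_blowUpVal.2 hξ
  have hbf : ∀ w, Generates ⊥ w.1 w.2 → bwd (fwd w) = w := by
    intro w hw
    simp only [bwd, fwd]
    rw [secondHalf_secondHalf notSimple_bot (hbot t) (hw.firstHalf h.q0 notSimple_bot (hbot t)),
      firstHalf_firstHalf h.q0 notSimple_bot (hbot t) hw]
  have hfb : ∀ w, Generates ⊥ w.1 w.2 → fwd (bwd w) = w := by
    intro w hw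
    simp only [bwd, fwd]
    rw [firstHalf_firstHalf h.q0 notSimple_bot (hbot t) (hw.secondHalf notSimple_bot (hbot t)),
      secondHalf_secondHalf notSimple_bot (hbot t) hw]
  have hgf : ∀ ξ, g (f ξ) = ξ := by
    intro ξ
    obtain ⟨k, a, hk⟩ := exists_rep ξ
    have h1 := hg' _ _ _ (gf _ k.generates) (hf' _ _ _ k.generates hk.genericPair)
    rw [hbf _ k.generates] at h1
    exact h1.unique hk.genericPair
  have hfg : ∀ ξ, f (g ξ) = ξ := by
    intro ξ
    obtain ⟨k, a, hk⟩ := exists_rep ξ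
    have h1 := hf' _ _ _ (gb _ k.generates) (hg' _ _ _ k.generates hk.genericPair)
    rw [hfb _ k.generates] at h1
    exact h1.unique hk.genericPair
  refine ⟨⟨f, g, hgf, hfg⟩, fun x hx => ?_, isRegular_of_transport (centers_finite _) gf hf',
    isRegular_of_transport (centers_finite _) gb hg'⟩
  obtain ⟨k, a, hk⟩ := exists_rep x
  have h1 := (hf' _ _ _ k.generates hk.genericPair).down
  have h2 := pval_painleveMap h ht notSimple_bot k.generates hx hk.genericPair.down.1
    hk.genericPair.down.2
  exact Prod.ext (h1.1.unique h2.1) (h1.2.unique h2.2)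

/-! ### Discrete solutions -/

theorem stepForward_eq (T : RatField) (w : RatField × RatField) :
    stepForward q S T w = secondHalf q S T (firstHalf q S T w) := by
  have h1 : zRhs q S T w.1 / w.2 = (firstHalf q S T w).2 := by
    simp only [zRhs, firstHalf, Params.rat, midParams, cst, cond_true, cond_false, map_inv₀ _ q]
    rw [mul_assoc (algebraMap ℂ RatField q), ← div_div, div_eq_inv_mul _ (algebraMap ℂ RatField q)]
  rw [stepForward, h1]
  refine Prod.ext ?_ rfl
  simp [yRhs, secondHalf, firstHalf, Params.rat, Params.swap, midParams, cst]

theorem stepBackward_eq (T : RatField) (w : RatField × RatField) :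
    stepBackward q S T w = firstHalf q S T (secondHalf q S T w) := by
  have h1 : yRhs q S T w.2 / w.1 = (secondHalf q S T w).1 := by
    simp [yRhs, secondHalf, Params.rat, Params.swap, midParams, cst]
  rw [stepBackward, h1]
  refine Prod.ext rfl ?_
  simp only [zRhs, firstHalf, secondHalf, Params.rat, midParams, cst, cond_true, cond_false,
    map_inv₀ _ q]
  rw [mul_assoc (algebraMap ℂ RatField q), ← div_div, div_eq_inv_mul _ (algebraMap ℂ RatField q)]

/-- The values of a generic pair and of its image under the step satisfy the recurrence. -/
theorem recurrence_of_pval {k : IntermediateField ℂ (RatFun σ)} (hk : NotSimple k) {T : RatFun σ}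
    (hTk : T ∈ k) (hq : q ≠ 0) {s : σ → ℂ} {t : ℂ} (hT : Val s T t) {w w' : RatFun σ × RatFun σ}
    (hw : Generates k w.1 w.2) (hw' : w' = secondHalf q S T (firstHalf q S T w))
    {y z y' z' : P1} (hy : PVal s w.1 y) (hz : PVal s w.2 z) (hy' : PVal s w'.1 y')
    (hz' : PVal s w'.2 z') : Recurrence q S t y z y' z' := by
  have hg := hw.firstHalf (S := S) hq hk hTk
  have hz1 : w'.2 = (firstHalf q S T w).2 := by rw [hw']; rfl
  obtain ⟨Ny, My, hNy, hMy, hMy0, ey⟩ := hy.exists_homogeneous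
  obtain ⟨Nz, Mz, hNz, hMz, hMz0, ez⟩ := hz.exists_homogeneous
  obtain ⟨Ny', My', hNy', hMy', hMy0', ey'⟩ := hy'.exists_homogeneous
  obtain ⟨Nz', Mz', hNz', hMz', hMz0', ez'⟩ := hz'.exists_homogeneous
  have hq' : algebraMap ℂ (RatFun σ) q ≠ 0 := (Val.const (a := s) q).ne_zero hq
  have hsub : ∀ c : ℂ, Ny - algebraMap ℂ _ c * My ≠ 0 := fun c hc =>
    hw.ne hk (k.algebraMap_mem c) (by rw [ey, div_eq_iff hMy0, sub_eq_zero.1 hc])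
  have hsub' : ∀ c : ℂ, Nz' - algebraMap ℂ _ c * Mz' ≠ 0 := fun c hc =>
    hg.symm.ne hk (k.algebraMap_mem c) (by rw [← hz1, ez', div_eq_iff hMz0', sub_eq_zero.1 hc])
  have hNy0 : Ny ≠ 0 := fun h => hw.ne_zero hk (by rw [ey, h, zero_div])
  have hNz0 : Nz ≠ 0 := fun h => hw.symm.ne_zero hk (by rw [ez, h, zero_div])
  -- `E1` and `E2` are the recurrence as identities of rational functions, cleared of denominators;
  -- both sides are regular at `s`, so comparing values gives the recurrence also at points at
  -- infinity.
  have E1 : Ny * Ny' * ((Nz' - algebraMap ℂ _ S.Θinf⁻¹ * Mz') *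
        (Nz' - algebraMap ℂ _ (S.Θinf / q) * Mz')) =
      My * My' * ((Nz' - T * algebraMap ℂ _ S.Θ0 * Mz') *
        (Nz' - T * algebraMap ℂ _ S.Θ0⁻¹ * Mz')) := by
    have h1 : w'.1 = Params.rat 1 (midParams q S T).swap w'.2 / w.1 := by rw [hw']; rfl
    have a1 := hsub' (S.Θinf / q)
    have a2 := hsub' S.Θinf⁻¹
    have a3 : ∀ c, Nz' / Mz' - c = (Nz' - c * Mz') / Mz' := fun c => by field_simp
    rw [ey', ez', ey] at h1
    simp only [Params.rat, Params.swap, midParams, cond_true, cond_false, a3] at h1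
    generalize Nz' - algebraMap ℂ _ (S.Θinf / q) * Mz' = u at *
    generalize Nz' - algebraMap ℂ _ S.Θinf⁻¹ * Mz' = v at *
    generalize Nz' - T * algebraMap ℂ _ S.Θ0 * Mz' = u' at *
    generalize Nz' - T * algebraMap ℂ _ S.Θ0⁻¹ * Mz' = v' at *
    field_simp at h1
    linear_combination h1
  have E2 : Nz * Nz' * (algebraMap ℂ _ q * (Ny - algebraMap ℂ _ S.Θ1 * My) *
        (Ny - algebraMap ℂ _ S.Θ1⁻¹ * My)) =
      Mz * Mz' * ((Ny - T * algebraMap ℂ _ S.Θt * My) *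
        (Ny - T * algebraMap ℂ _ S.Θt⁻¹ * My)) := by
    have h1 : w'.2 = Params.rat (algebraMap ℂ _ q⁻¹) (midParams q S T) w.1 / w.2 := hz1
    have a1 := hsub S.Θ1
    have a2 := hsub S.Θ1⁻¹
    have a3 : ∀ c, Ny / My - c = (Ny - c * My) / My := fun c => by field_simp
    rw [ez', ez, ey] at h1
    simp only [Params.rat, midParams, cond_true, cond_false, a3, map_inv₀ _ q] at h1
    generalize Ny - algebraMap ℂ _ S.Θ1 * My = u at *
    generalize Ny - algebraMap ℂ _ S.Θ1⁻¹ * My = v at *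
    generalize Ny - T * algebraMap ℂ _ S.Θt * My = u' at *
    generalize Ny - T * algebraMap ℂ _ S.Θt⁻¹ * My = v' at *
    field_simp at h1
    linear_combination h1
  constructor
  · refine Val.unique ((hNy.mul hNy').mul ((hNz'.sub ((Val.const _).mul hMz')).mul
      (hNz'.sub ((Val.const _).mul hMz')))) ?_
    rw [E1]
    exact (hMy.mul hMy').mul ((hNz'.sub ((hT.mul (Val.const _)).mul hMz')).mul
      (hNz'.sub ((hT.mul (Val.const _)).mul hMz')))
  · refine Val.unique ((hNz.mul hNz').mul (((Val.const q).mul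
      (hNy.sub ((Val.const _).mul hMy))).mul (hNy.sub ((Val.const _).mul hMy)))) ?_
    rw [E2]
    exact (hMz.mul hMz').mul ((hNy.sub ((hT.mul (Val.const _)).mul hMy)).mul
      (hNy.sub ((hT.mul (Val.const _)).mul hMy)))

/-- The field of rational functions of the time variable. -/
def timeField : IntermediateField ℂ RatField := IntermediateField.adjoin ℂ {var 2}

theorem notSimple_timeField : NotSimple timeField := notSimple_adjoin (var 2)

/-- The time after `l` steps, as a function of the initial time. -/
def timeAt (q : ℂ) (l : ℤ) : RatField := cst (q ^ l) * var 2

theorem timeAt_mem (l : ℤ) : timeAt q l ∈ timeField :=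
  mul_mem (timeField.algebraMap_mem _) (IntermediateField.subset_adjoin ℂ _ rfl)

theorem algebraMap_mul_timeAt (hq : q ≠ 0) (l : ℤ) :
    algebraMap ℂ _ q * timeAt q l = timeAt q (l + 1) := by
  rw [timeAt, timeAt, cst, cst, ← mul_assoc, ← map_mul, zpow_add_one₀ hq, mul_comm q]

theorem generates_var : Generates timeField (var 0) (var 1) := by
  intro L hL h0 h1
  refine eq_top_of_X_mem fun i => ?_
  fin_cases i
  exacts [h0, h1, hL (IntermediateField.subset_adjoin ℂ _ rfl)]

/-- The generic pair `w` at the time `T` has a value at `s` on the surface at time `t`. -/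
def HasValue (q : ℂ) (S : Spectral) (s : σ → ℂ) (T : RatFun σ) (t : ℂ)
    (w : RatFun σ × RatFun σ) : Prop :=
  ∃ ξ : Surface q S t, PtVal s (surfParams q S T) (surfParams q S t) w.1 w.2 ξ

theorem zpow_mul_zpow (hq : q ≠ 0) (l : ℤ) (t : ℂ) : q * (q ^ l * t) = q ^ (l + 1) * t := by
  rw [zpow_add_one₀ hq]
  ring

theorem val_var (s : Fin 3 → ℂ) (i : Fin 3) : Val s (var i) (s i) := by
  have h := Val.ofPoly (a := s) (MvPolynomial.X i)
  rwa [MvPolynomial.eval_X] at h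

theorem val_timeAt (s : Fin 3 → ℂ) (l : ℤ) : Val s (timeAt q l) (q ^ l * s 2) :=
  (Val.const _).mul (val_var s 2)

theorem iterate_natCast_succ (n : ℕ) :
    iterate q S ((n : ℤ) + 1) = secondHalf q S (timeAt q n)
      (firstHalf q S (timeAt q n) (iterate q S n)) := by
  rw [← stepForward_eq]
  change stepForward q S (cst (q ^ n) * var 2) (iterForward q S n) =
    stepForward q S (cst (q ^ (n : ℤ)) * var 2) (iterForward q S n)
  rw [zpow_natCast]

theorem iterate_neg_natCast_succ (n : ℕ) :
    iterate q S (-(n + 1 : ℤ)) = firstHalf q S (timeAt q (-(n + 1 : ℤ)))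
      (secondHalf q S (timeAt q (-(n + 1 : ℤ))) (iterate q S (-(n : ℤ)))) := by
  rw [← stepBackward_eq]
  have h1 : ∀ m : ℕ, iterate q S (-(m : ℤ)) = iterBackward q S m := by
    rintro (_ | m) <;> rfl
  have h2 := h1 (n + 1)
  rw [Nat.cast_add, Nat.cast_one] at h2
  rw [h2, h1]
  rfl

/-- Induction in both directions: the time stays good and the pair stays generic, so transport
applies at every step. -/
theorem generates_iterate_and_hasValue (h : Admissible q S) {s : Fin 3 → ℂ} (h0 : s 0 ≠ 0)
    (h1 : s 1 ≠ 0) (ht : GoodTime q S (s 2)) (l : ℤ) :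
    Generates timeField (iterate q S l).1 (iterate q S l).2 ∧
      HasValue q S s (timeAt q l) (q ^ l * s 2) (iterate q S l) := by
  have hzero : Generates timeField (iterate q S 0).1 (iterate q S 0).2 ∧
      HasValue q S s (timeAt q 0) (q ^ (0 : ℤ) * s 2) (iterate q S 0) := by
    -- Every centre has a coordinate equal to `0` or `∞`, so the initial point is not blown up.
    refine ⟨generates_var, .base (((s 0 : ℂ) : P1), ((s 1 : ℂ) : P1)) ?_, val_var s 0, val_var s 1⟩
    rw [centers_eq_range]
    rintro ⟨i | i | i | i, hi⟩
    · exact h0 (OnePoint.coe_eq_coe.1 (Prod.mk.inj hi).1).symm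
    · exact OnePoint.infty_ne_coe _ (Prod.mk.inj hi).2
    · exact h1 (OnePoint.coe_eq_coe.1 (Prod.mk.inj hi).2).symm
    · exact OnePoint.infty_ne_coe _ (Prod.mk.inj hi).1
  have hpos : ∀ n : ℕ, Generates timeField (iterate q S n).1 (iterate q S n).2 ∧
      HasValue q S s (timeAt q n) (q ^ (n : ℤ) * s 2) (iterate q S n) := by
    intro n
    induction n with
    | zero => exact hzero
    | succ n ih =>
      obtain ⟨hg, ξ, hξ⟩ := ih
      obtain ⟨η, hη⟩ := forward_transport (σ := Fin 3) h (ht.zpow_mul h n) ξ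
      have h2 := hη s timeField _ _ notSimple_timeField (timeAt_mem n) (val_timeAt s n) hg hξ
      rw [Nat.cast_add, Nat.cast_one, iterate_natCast_succ]
      refine ⟨(hg.firstHalf h.q0 notSimple_timeField (timeAt_mem n)).secondHalf
        notSimple_timeField (timeAt_mem n), ?_⟩
      rw [← algebraMap_mul_timeAt h.q0, ← zpow_mul_zpow h.q0]
      exact ⟨η, h2⟩
  have hneg : ∀ n : ℕ, Generates timeField (iterate q S (-n)).1 (iterate q S (-n)).2 ∧
      HasValue q S s (timeAt q (-n)) (q ^ (-n : ℤ) * s 2) (iterate q S (-n)) := by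
    intro n
    induction n with
    | zero => exact hzero
    | succ n ih =>
      obtain ⟨hg, hv⟩ := ih
      -- The backward step from index `-n` is the inverse of the forward step at time index `-(n +
      -- 1)`, so its source surface must be written as the one at `q` times that time.
      have e : (-(n : ℤ)) = -(n + 1 : ℤ) + 1 := by ring
      have hv' : HasValue q S s (algebraMap ℂ _ q * timeAt q (-(n + 1 : ℤ)))
          (q * (q ^ (-(n + 1 : ℤ)) * s 2)) (iterate q S (-(n : ℤ))) := by
        rw [algebraMap_mul_timeAt h.q0, zpow_mul_zpow h.q0, ← e]
        exact hv
      obtain ⟨ξ, hξ⟩ := hv'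
      obtain ⟨η, hη⟩ := backward_transport (σ := Fin 3) h (ht.zpow_mul h (-(n + 1 : ℤ))) ξ
      have h2 := hη s timeField _ _ notSimple_timeField (timeAt_mem _) (val_timeAt s _) hg hξ
      rw [Nat.cast_add, Nat.cast_one, iterate_neg_natCast_succ]
      exact ⟨(hg.secondHalf notSimple_timeField (timeAt_mem _)).firstHalf h.q0
        notSimple_timeField (timeAt_mem _), η, h2⟩
  obtain ⟨n, rfl | rfl⟩ := l.eq_nat_or_neg
  exacts [hpos n, hneg n]

/-- For negative `l` the iterates are defined by backward steps, which the forward step undoes on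
generic pairs. -/
theorem iterate_succ (h : Admissible q S) {s : Fin 3 → ℂ} (h0 : s 0 ≠ 0) (h1 : s 1 ≠ 0)
    (ht : GoodTime q S (s 2)) (l : ℤ) :
    iterate q S (l + 1) = secondHalf q S (timeAt q l)
      (firstHalf q S (timeAt q l) (iterate q S l)) := by
  rcases l with n | n
  · exact iterate_natCast_succ n
  · have hg := (generates_iterate_and_hasValue h h0 h1 ht (-(n : ℤ))).1
    have h2 := iterate_neg_natCast_succ (q := q) (S := S) n
    have e : Int.negSucc n = -(n + 1 : ℤ) := Int.negSucc_eq n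
    have e' : -(n + 1 : ℤ) + 1 = -(n : ℤ) := by ring
    rw [e, e', h2, firstHalf_firstHalf h.q0 notSimple_timeField (timeAt_mem _)
      (hg.secondHalf notSimple_timeField (timeAt_mem _)),
      secondHalf_secondHalf notSimple_timeField (timeAt_mem _) hg]

theorem SatisfiesSimplified.eq_of_pval {φ : RatField} {s : Fin 3 → ℂ} {v p : P1}
    (h : SatisfiesSimplified φ s v) (hp : PVal s φ p) : v = p := by
  obtain ⟨P, Q, hQ, hφ, hu⟩ := hp.exists_poly
  exact hu v (h P Q hQ hφ)

/-- The solution consists of the images downstairs of the values on the successive surfaces. For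
uniqueness, the simplified relations alone determine both projective coordinates of each term. -/
theorem existsUnique_isDiscreteSolution (h : Admissible q S) {y₀ z₀ t₀ : ℂ} (hy : y₀ ≠ 0)
    (hz : z₀ ≠ 0) (ht : GoodTime q S t₀) :
    ∃! s : ℤ → P1 × P1 × ℂ, IsDiscreteSolution q S y₀ z₀ t₀ s := by
  have hmain : ∀ l, _ := generates_iterate_and_hasValue (s := ![y₀, z₀, t₀]) h hy hz ht
  choose hg ξ hξ using hmain
  have hv := fun l => (hξ l).down
  have hv0 : (ξ 0).down = ((y₀ : P1), (z₀ : P1)) :=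
    Prod.ext ((hv 0).1.unique (val_var ![y₀, z₀, t₀] 0))
      ((hv 0).2.unique (val_var ![y₀, z₀, t₀] 1))
  refine ⟨fun l => ((ξ l).down.1, (ξ l).down.2, q ^ l * t₀), ⟨?_, fun l => rfl, fun l => ?_,
    fun l => ⟨fun P Q hQ hφ => (hv l).1.num_mul_eval hQ hφ,
      fun P Q hQ hφ => (hv l).2.num_mul_eval hQ hφ⟩⟩, fun s hs => ?_⟩
  · have h1 := congrArg Prod.fst hv0
    have h2 := congrArg Prod.snd hv0
    exact Prod.ext h1 (Prod.ext h2 (by simp))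
  · exact recurrence_of_pval notSimple_timeField (timeAt_mem l) h.q0
      (val_timeAt ![y₀, z₀, t₀] l) (hg l) (iterate_succ (s := ![y₀, z₀, t₀]) h hy hz ht l)
      (hv l).1 (hv l).2 (hv (l + 1)).1 (hv (l + 1)).2
  · funext l
    exact Prod.ext ((hs.simplified l).1.eq_of_pval (hv l).1)
      (Prod.ext ((hs.simplified l).2.eq_of_pval (hv l).2) (hs.time l))

end

end QPVI

end

theorem mainTheorem9 (q : ℂ) (hq0 : q ≠ 0) (hq1 : q ≠ 1) (S : QPVI.Spectral)
    (h0 : S.Θ0 ≠ 0) (h1 : S.Θ1 ≠ 0) (ht : S.Θt ≠ 0) (hinf : S.Θinf ≠ 0)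
    (h0' : S.Θ0 ^ 2 ≠ 1) (h1' : S.Θ1 ^ 2 ≠ 1) (ht' : S.Θt ^ 2 ≠ 1) (hinf' : S.Θinf ^ 2 ≠ q) :
    (∀ t : ℂ, t ≠ 0 → t ∉ QPVI.excludedTimes q S →
      ∃ F : QPVI.Surface q S t ≃ QPVI.Surface q S (q * t),
        (∀ x : QPVI.Surface q S t, x.down ∉ QPVI.centers q S t →
          (F x).down = QPVI.painleveMap q S t x.down) ∧
        QPVI.IsRegular F ∧ QPVI.IsRegular F.symm ∧
        QPVI.IsHolomorphic F ∧ QPVI.IsHolomorphic F.symm) ∧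
    (∀ y₀ z₀ t₀ : ℂ, y₀ ≠ 0 → z₀ ≠ 0 → t₀ ≠ 0 → t₀ ∉ QPVI.excludedTimes q S →
      ∃! s : ℤ → QPVI.P1 × QPVI.P1 × ℂ, QPVI.IsDiscreteSolution q S y₀ z₀ t₀ s) := by
  have h : QPVI.Admissible q S := ⟨hq0, h0, h1, ht, hinf, h0', h1', ht', hinf'⟩
  refine ⟨fun t ht0 htS => ?_, fun y₀ z₀ t₀ hy hz ht0 htS =>
    QPVI.existsUnique_isDiscreteSolution h hy hz ⟨ht0, htS⟩⟩
  obtain ⟨F, hF, hr, hr'⟩ := QPVI.exists_surface_equiv h ⟨ht0, htS⟩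
  exact ⟨F, hF, hr, hr', hr.isHolomorphic, hr'.isHolomorphic⟩
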